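/- **Setting.** For $i=1,2$ let $\Sigma_i$ be a port-Hamiltonian system $\dot x_i=B_i(x_i)\nabla H_i(x_i)+G_i(x_i)u_i$, $y_i=G_i(x_i)^\top\nabla H_i(x_i)$ with $x_i\in\mathbb R^{n_i}$, $u_i,y_i\in\mathbb R^m$, $B_i=J_i-R_i$, $J_i(x_i)$ skew-symmetric, $R_i(x_i)$ symmetric positive semidefinite, $J_i,R_i,G_i$ locally Lipschitz and $H_i$ of class $C^2$. Put $\xi=(x_1,x_2)$, $\mathcal H(\xi)=H_1(x_1)+H_2(x_2)$ and $$A(\xi)=\begin{bmatrix}B_1(x_1)&-G_1(x_1)G_2(x_2)^\top\\0&B_2(x_2)\end{bmatrix},\quad A_d(\xi)=\begin{bmatrix}0&0\\G_2(x_2)G_1(x_1)^\top&0\end{bmatrix},\quad A_e(\xi)=\begin{bmatrix}0\\G_2(x_2)\end{bmatrix},\quad \mathcal G(\xi)=\begin{bmatrix}G_1(x_1)^\top&0\end{bmatrix}.$$ Fix $\sigma,h,\tau_M>0$, put $\delta_M=h+\tau_M$, and let $\Omega\succ0$ be an $m\times m$ matrix. The output $y_1$ is sampled at $\ell h$, $\ell=0,1,2,\dots$.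 The sample $y_1(\ell h)$ is transmitted exactly when $e^\top\Omega e\ge\sigma\,y_1(\ell h)^\top\Omega\,y_1(\ell h)$, where $e$ is the value transmitted last before $\ell h$ minus $y_1(\ell h)$ (an arbitrary stored value $w\in\mathbb R^m$ is used before the first transmission). Let $\hat y(\ell h)$ be the value transmitted last up to and including $\ell h$ (or $w$), and $e(\ell h)=\hat y(\ell h)-y_1(\ell h)$. The delay satisfies $0<\tau_m\le\tau(t)\le\tau_M$, and $s_\ell:=\ell h+\tau(\ell h)$ is nondecreasing in $\ell$. The interconnected delayed system is $$\dot\xi(t)=A(\xi(t))\nabla\mathcal H(\xi(t))+A_d(\xi(t))\nabla\mathcal H(\xi(\ell h))+A_e(\xi(t))\,e(\ell h),\qquad t\in[s_\ell,s_{\ell+1}),\ \ell\ge0,\tag{1}$$ i.e. with delay $\delta(t)=t-\ell h$; its initial data at $t_0=s_0$ are a continuous function on $[t_0-\delta_M,t_0]$, measured in the supremum norm, and $w$. Assume that $\mathcal H(0)=0$, $\nabla\mathcal H(0)=0$, and $\mathcal H(\xi)>0$, $\nabla\mathcal H(\xi)\ne0$ for all $\xi\neq0$ in a neighbourhood of $0$.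 For matrices $P,Q$ of size $n_1+n_2$ and states $\xi,\zeta$ let, with $A,A_d,A_e$ and $D=\nabla^2\mathcal H$ taken at $\xi$, $$\Xi(\xi,\zeta)=\begin{bmatrix}\Xi_{11}&\Xi_{21}^\top&6Q&\Xi_{41}^\top\\\Xi_{21}&\Xi_{22}&6Q&\Xi_{42}^\top\\6Q&6Q&-12Q&0\\\Xi_{41}&\Xi_{42}&0&\Xi_{44}\end{bmatrix},$$ $\Xi_{11}=\tfrac12(A+A^\top)+A^\top D^\top P+PDA+\delta_M^2A^\top D^\top QDA-4Q$, $\Xi_{21}=A_d^\top D^\top P+\tfrac12A_d^\top+\delta_M^2A_d^\top D^\top QDA-2Q$, $\Xi_{22}=\delta_M^2A_d^\top D^\top QDA_d-4Q+\sigma\,\mathcal G(\zeta)^\top\Omega\,\mathcal G(\zeta)$, $\Xi_{41}=A_e^\top D^\top P+\tfrac12A_e^\top+\delta_M^2A_e^\top D^\top QDA$, $\Xi_{42}=\delta_M^2A_e^\top D^\top QDA_d$, $\Xi_{44}=\delta_M^2A_e^\top D^\top QDA_e-\Omega$. **Theorem.** Let $P\succ0$, $Q\succ0$, $\Omega\succ0$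 be constant matrices. 1. If $\Xi(\xi,\xi)\prec0$ for all $\xi$ in a neighbourhood of $0$, then the zero solution of (1) is asymptotically stable: for every $\varepsilon>0$ there is $r>0$ such that all initial functions of norm less than $r$, whatever $w$, have solutions on $[t_0,\infty)$ and all these solutions satisfy $\|\xi(t)\|<\varepsilon$ for $t\ge t_0$; and for some $r>0$ all solutions with initial function of norm less than $r$ tend to $0$ as $t\to\infty$. 2. Suppose that $\Xi(\xi,\zeta)\prec0$ for all $\xi,\zeta\in\mathbb R^{n_1+n_2}$ (if $G_1$ is constant: $\Xi(\xi,\xi)\prec0$ for all $\xi$), that $\mathcal H(\xi)>0$ and $\nabla\mathcal H(\xi)\neq0$ for all $\xi\ne0$, and that $\mathcal H(\xi)+\|\nabla\mathcal H(\xi)\|\to\infty$ as $\|\xi\|\to\infty$. Then the zero solution of (1) is globally asymptotically stable: it is stable, all initial data have solutions on $[t_0,\infty)$, and all solutions tend to $0$ as $t\to\infty$. -/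

import Mathlib

open Set Filter Topology
open scoped Matrix

/-- An input-state-output port-Hamiltonian system
`x' = (J(x) - R(x)) ∇H(x) + G(x) u`, `y = G(x)ᵀ ∇H(x)` with state in `ℝⁿ` and input and output
in `ℝᵐ`: `J` is skew-symmetric, `R` is positive semidefinite (`R = 0` being the lossless case),
the coefficients are locally Lipschitz and the Hamiltonian is twice continuously differentiable. -/
structure PortHamiltonian (n m : ℕ) where
  J : EuclideanSpace ℝ (Fin n) → Matrix (Fin n) (Fin n) ℝ
  R : EuclideanSpace ℝ (Fin n) → Matrix (Fin n) (Fin n) ℝ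
  G : EuclideanSpace ℝ (Fin n) → Matrix (Fin n) (Fin m) ℝ
  H : EuclideanSpace ℝ (Fin n) → ℝ
  J_skew : ∀ x, (J x)ᵀ = -J x
  R_posSemidef : ∀ x, (R x).PosSemidef
  J_lipschitz : ∀ i j, LocallyLipschitz fun x => J x i j
  R_lipschitz : ∀ i j, LocallyLipschitz fun x => R x i j
  G_lipschitz : ∀ i j, LocallyLipschitz fun x => G x i j
  H_contDiff : ContDiff ℝ 2 H

namespace PortHamiltonian

noncomputable section

variable {n n₁ n₂ m : ℕ}

/-- `B(x) = J(x) - R(x)`. -/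
def B (S : PortHamiltonian n m) (x : EuclideanSpace ℝ (Fin n)) : Matrix (Fin n) (Fin n) ℝ :=
  S.J x - S.R x

/-- The output `y = G(x)ᵀ ∇H(x)` at the state `x`. -/
def output (S : PortHamiltonian n m) (x : EuclideanSpace ℝ (Fin n)) : Fin m → ℝ :=
  (S.G x)ᵀ *ᵥ (gradient S.H x).ofLp

/-- The state space of the interconnection, `ξ = (x₁, x₂)`, with its Euclidean norm. -/
abbrev State (n₁ n₂ : ℕ) : Type := EuclideanSpace ℝ (Fin n₁ ⊕ Fin n₂)

/-- The component `x₁` of `ξ = (x₁, x₂)`. -/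
def State.fst (ξ : State n₁ n₂) : EuclideanSpace ℝ (Fin n₁) :=
  WithLp.toLp 2 fun i => ξ (Sum.inl i)

/-- The component `x₂` of `ξ = (x₁, x₂)`. -/
def State.snd (ξ : State n₁ n₂) : EuclideanSpace ℝ (Fin n₂) :=
  WithLp.toLp 2 fun i => ξ (Sum.inr i)

/-- The Hessian of `f`, as the Jacobian matrix of its gradient. -/
def hessian {ι : Type} [Fintype ι] [DecidableEq ι] (f : EuclideanSpace ℝ ι → ℝ)
    (x : EuclideanSpace ℝ ι) : Matrix ι ι ℝ :=
  Matrix.of fun i j => (fderiv ℝ (gradient f) x (EuclideanSpace.single j 1)) i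

variable (S₁ : PortHamiltonian n₁ m) (S₂ : PortHamiltonian n₂ m)

/-- The total energy `𝓗(ξ) = H₁(x₁) + H₂(x₂)`. -/
def energy (ξ : State n₁ n₂) : ℝ := S₁.H ξ.fst + S₂.H ξ.snd

/-- `A = [B₁, -G₁ G₂ᵀ; 0, B₂]`. -/
def matA (ξ : State n₁ n₂) : Matrix (Fin n₁ ⊕ Fin n₂) (Fin n₁ ⊕ Fin n₂) ℝ :=
  Matrix.fromBlocks (S₁.B ξ.fst) (-(S₁.G ξ.fst * (S₂.G ξ.snd)ᵀ)) 0 (S₂.B ξ.snd)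

/-- `A_d = [0, 0; G₂ G₁ᵀ, 0]`. -/
def matAd (ξ : State n₁ n₂) : Matrix (Fin n₁ ⊕ Fin n₂) (Fin n₁ ⊕ Fin n₂) ℝ :=
  Matrix.fromBlocks 0 0 (S₂.G ξ.snd * (S₁.G ξ.fst)ᵀ) 0

/-- `A_e = [0; G₂]`. -/
def matAe (ξ : State n₁ n₂) : Matrix (Fin n₁ ⊕ Fin n₂) (Fin m) ℝ :=
  Matrix.fromRows 0 (S₂.G ξ.snd)

/-- `𝒢 = [G₁ᵀ, 0]`, so that `y₁ = 𝒢 ∇𝓗`. -/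
def matG (ζ : State n₁ n₂) : Matrix (Fin m) (Fin n₁ ⊕ Fin n₂) ℝ :=
  Matrix.fromCols (S₁.G ζ.fst)ᵀ 0

/-- The event function `𝒞(e, y) = eᵀ Ω e - σ yᵀ Ω y`. -/
def eventFun (σ : ℝ) (Ω : Matrix (Fin m) (Fin m) ℝ) (e y : Fin m → ℝ) : ℝ :=
  e ⬝ᵥ (Ω *ᵥ e) - σ * (y ⬝ᵥ (Ω *ᵥ y))

/-- The value `y(t_k)` transmitted last, up to and including the `ℓ`-th sampling instant, where
`y ℓ` is the output sampled at that instant and `w` is the value that was stored before the first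
sample. A sample is transmitted exactly when `𝒞(e, y) ≥ 0`, `e` being the difference
between the stored value and the current sample. -/
def lastSent (σ : ℝ) (Ω : Matrix (Fin m) (Fin m) ℝ) (w : Fin m → ℝ) (y : ℕ → Fin m → ℝ) :
    ℕ → Fin m → ℝ
  | 0 => if 0 ≤ eventFun σ Ω (w - y 0) (y 0) then y 0 else w
  | ℓ + 1 =>
    if 0 ≤ eventFun σ Ω (lastSent σ Ω w y ℓ - y (ℓ + 1)) (y (ℓ + 1)) then y (ℓ + 1)
    else lastSent σ Ω w y ℓ

/-- The error `e(ℓh) = y₁(t_k) - y₁(ℓh)` along the trajectory `ξ`, `t_k` being the last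
transmission instant up to and including `ℓh`. -/
def sampleError (σ h : ℝ) (Ω : Matrix (Fin m) (Fin m) ℝ) (w : Fin m → ℝ)
    (ξ : ℝ → State n₁ n₂) (ℓ : ℕ) : Fin m → ℝ :=
  lastSent σ Ω w (fun k : ℕ => S₁.output (ξ (k * h)).fst) ℓ - S₁.output (ξ (ℓ * h)).fst

/-- The instant `ℓh + τ(ℓh)` from which on the sample taken at `ℓh` is in force. -/
def arrival (h : ℝ) (τ : ℝ → ℝ) (ℓ : ℕ) : ℝ := ℓ * h + τ (ℓ * h)

/-- Admissible network delays: `0 < τ_m ≤ τ(t) ≤ τ_M`, and data arrive in the order in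
which they were sampled. -/
def AdmissibleDelay (h τm τM : ℝ) (τ : ℝ → ℝ) : Prop :=
  0 < τm ∧ (∀ t, 0 ≤ t → τm ≤ τ t ∧ τ t ≤ τM) ∧ Monotone (arrival h τ)

/-- The right-hand side `A(ξ) ∇𝓗(ξ) + A_d(ξ) ∇𝓗(ξd) + A_e(ξ) e`. -/
def field (ξ ξd : State n₁ n₂) (e : Fin m → ℝ) : State n₁ n₂ :=
  WithLp.toLp 2 (matA S₁ S₂ ξ *ᵥ (gradient (energy S₁ S₂) ξ).ofLp
    + matAd S₁ S₂ ξ *ᵥ (gradient (energy S₁ S₂) ξd).ofLp + matAe S₂ ξ *ᵥ e)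

/-- The interval `[t₀ - δ_M, t₀]` of initial times, where `δ_M = h + τ_M` and `t₀ = τ(0)` is the
instant at which the first sample comes into force. -/
def historyInterval (h τM : ℝ) (τ : ℝ → ℝ) : Set ℝ :=
  Icc (arrival h τ 0 - (h + τM)) (arrival h τ 0)

/-- `ξ` solves
`ξ'(t) = A ∇𝓗(ξ(t)) + A_d ∇𝓗(ξ(t - δ(t))) + A_e e(t - δ(t))` for all `t ≥ t₀`, where
`t - δ(t) = ℓh` for `t ∈ [ℓh + τ(ℓh), (ℓ+1)h + τ((ℓ+1)h))`, under the periodic event-triggering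
mechanism. The derivative is the right derivative, since the right-hand side may jump
at the arrival instants. -/
def IsSolution (σ h τM : ℝ) (Ω : Matrix (Fin m) (Fin m) ℝ) (τ : ℝ → ℝ) (w : Fin m → ℝ)
    (ξ : ℝ → State n₁ n₂) : Prop :=
  ContinuousOn ξ (Ici (arrival h τ 0 - (h + τM))) ∧
    ∀ ℓ : ℕ, ∀ t ∈ Ico (arrival h τ ℓ) (arrival h τ (ℓ + 1)),
      HasDerivWithinAt ξ (field S₁ S₂ (ξ t) (ξ (ℓ * h)) (sampleError S₁ σ h Ω w ξ ℓ)) (Ici t) t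

/-- Every continuous initial function of norm less than `r` on the initial interval is continued
by a solution that exists for all later times. -/
def ForwardComplete (σ h τM : ℝ) (Ω : Matrix (Fin m) (Fin m) ℝ) (τ : ℝ → ℝ) (r : ℝ) : Prop :=
  ∀ (φ : ℝ → State n₁ n₂) (w : Fin m → ℝ), ContinuousOn φ (historyInterval h τM τ) →
    (∀ t ∈ historyInterval h τM τ, ‖φ t‖ < r) →
    ∃ ξ : ℝ → State n₁ n₂, EqOn ξ φ (historyInterval h τM τ) ∧ IsSolution S₁ S₂ σ h τM Ω τ w ξ

/-- Lyapunov stability of the zero solution, in the supremum norm of the initial function. -/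
def IsStable (σ h τM : ℝ) (Ω : Matrix (Fin m) (Fin m) ℝ) (τ : ℝ → ℝ) : Prop :=
  ∀ ε > 0, ∃ r > 0, ForwardComplete S₁ S₂ σ h τM Ω τ r ∧
    ∀ (w : Fin m → ℝ) (ξ : ℝ → State n₁ n₂), IsSolution S₁ S₂ σ h τM Ω τ w ξ →
      (∀ t ∈ historyInterval h τM τ, ‖ξ t‖ < r) → ∀ t ≥ arrival h τ 0, ‖ξ t‖ < ε

/-- Asymptotic stability of the zero solution: stability and local attractivity. -/
def IsAsymptoticallyStable (σ h τM : ℝ) (Ω : Matrix (Fin m) (Fin m) ℝ) (τ : ℝ → ℝ) : Prop :=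
  IsStable S₁ S₂ σ h τM Ω τ ∧
    ∃ r > 0, ∀ (w : Fin m → ℝ) (ξ : ℝ → State n₁ n₂), IsSolution S₁ S₂ σ h τM Ω τ w ξ →
      (∀ t ∈ historyInterval h τM τ, ‖ξ t‖ < r) → Tendsto ξ atTop (𝓝 0)

/-- Global asymptotic stability of the zero solution: stability, existence of solutions for all
initial functions and all later times, and global attractivity. -/
def IsGloballyAsymptoticallyStable (σ h τM : ℝ) (Ω : Matrix (Fin m) (Fin m) ℝ) (τ : ℝ → ℝ) :
    Prop :=
  IsStable S₁ S₂ σ h τM Ω τ ∧ (∀ r, ForwardComplete S₁ S₂ σ h τM Ω τ r) ∧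
    ∀ (w : Fin m → ℝ) (ξ : ℝ → State n₁ n₂), IsSolution S₁ S₂ σ h τM Ω τ w ξ →
      Tendsto ξ atTop (𝓝 0)

/-- `𝓗` is regular and positive definite around `0`. -/
def RegularPosDef : Prop :=
  energy S₁ S₂ 0 = 0 ∧ gradient (energy S₁ S₂) 0 = 0 ∧
    ∀ᶠ ξ in 𝓝[≠] (0 : State n₁ n₂), 0 < energy S₁ S₂ ξ ∧ gradient (energy S₁ S₂) ξ ≠ 0

/-- `𝓗` is regular and positive definite on the whole space, and `𝓗 + ‖∇𝓗‖` is
radially unbounded. -/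
def GloballyRegularPosDef : Prop :=
  energy S₁ S₂ 0 = 0 ∧ gradient (energy S₁ S₂) 0 = 0 ∧
    (∀ ξ : State n₁ n₂, ξ ≠ 0 → 0 < energy S₁ S₂ ξ ∧ gradient (energy S₁ S₂) ξ ≠ 0) ∧
    Tendsto (fun ξ : State n₁ n₂ => energy S₁ S₂ ξ + ‖gradient (energy S₁ S₂) ξ‖)
      (cocompact (State n₁ n₂)) atTop

section LMI

variable (σ δM : ℝ) (P Q : Matrix (Fin n₁ ⊕ Fin n₂) (Fin n₁ ⊕ Fin n₂) ℝ)
  (Ω : Matrix (Fin m) (Fin m) ℝ) (ξ ζ : State n₁ n₂)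

def Xi11 : Matrix (Fin n₁ ⊕ Fin n₂) (Fin n₁ ⊕ Fin n₂) ℝ :=
  let A := matA S₁ S₂ ξ
  let D := hessian (energy S₁ S₂) ξ
  (1 / 2 : ℝ) • (A + Aᵀ) + Aᵀ * Dᵀ * P + P * D * A + δM ^ 2 • (Aᵀ * Dᵀ * Q * D * A) - (4 : ℝ) • Q

def Xi21 : Matrix (Fin n₁ ⊕ Fin n₂) (Fin n₁ ⊕ Fin n₂) ℝ :=
  let A := matA S₁ S₂ ξ
  let Ad := matAd S₁ S₂ ξ
  let D := hessian (energy S₁ S₂) ξ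
  Adᵀ * Dᵀ * P + (1 / 2 : ℝ) • Adᵀ + δM ^ 2 • (Adᵀ * Dᵀ * Q * D * A) - (2 : ℝ) • Q

/-- The matrix `𝒢` is taken at its own argument `ζ`. -/
def Xi22 : Matrix (Fin n₁ ⊕ Fin n₂) (Fin n₁ ⊕ Fin n₂) ℝ :=
  let Ad := matAd S₁ S₂ ξ
  let D := hessian (energy S₁ S₂) ξ
  let 𝒢 : Matrix (Fin m) (Fin n₁ ⊕ Fin n₂) ℝ := matG S₁ ζ
  δM ^ 2 • (Adᵀ * Dᵀ * Q * D * Ad) - (4 : ℝ) • Q + σ • (𝒢ᵀ * Ω * 𝒢)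

def Xi41 : Matrix (Fin m) (Fin n₁ ⊕ Fin n₂) ℝ :=
  let A := matA S₁ S₂ ξ
  let Ae := matAe S₂ ξ
  let D := hessian (energy S₁ S₂) ξ
  Aeᵀ * Dᵀ * P + (1 / 2 : ℝ) • Aeᵀ + δM ^ 2 • (Aeᵀ * Dᵀ * Q * D * A)

def Xi42 : Matrix (Fin m) (Fin n₁ ⊕ Fin n₂) ℝ :=
  let Ad := matAd S₁ S₂ ξ
  let Ae := matAe S₂ ξ
  let D := hessian (energy S₁ S₂) ξ
  δM ^ 2 • (Aeᵀ * Dᵀ * Q * D * Ad)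

def Xi44 : Matrix (Fin m) (Fin m) ℝ :=
  let Ae := matAe S₂ ξ
  let D := hessian (energy S₁ S₂) ξ
  δM ^ 2 • (Aeᵀ * Dᵀ * Q * D * Ae) - Ω

/-- The symmetric `4 × 4` block matrix `Ξ`, with block rows and columns `1, 2 | 3, 4`. The
coefficients `A`, `A_d`, `A_e` and the Hessian of `𝓗` are taken at the current state `ξ`, and
`𝒢` at the delayed state `ζ`. -/
def Xi : Matrix (((Fin n₁ ⊕ Fin n₂) ⊕ (Fin n₁ ⊕ Fin n₂)) ⊕ ((Fin n₁ ⊕ Fin n₂) ⊕ Fin m))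
    (((Fin n₁ ⊕ Fin n₂) ⊕ (Fin n₁ ⊕ Fin n₂)) ⊕ ((Fin n₁ ⊕ Fin n₂) ⊕ Fin m)) ℝ :=
  let lower := Matrix.fromBlocks ((6 : ℝ) • Q) ((6 : ℝ) • Q)
    (Xi41 S₁ S₂ δM P Q ξ) (Xi42 S₁ S₂ δM Q ξ)
  Matrix.fromBlocks
    (Matrix.fromBlocks (Xi11 S₁ S₂ δM P Q ξ) (Xi21 S₁ S₂ δM P Q ξ)ᵀ
      (Xi21 S₁ S₂ δM P Q ξ) (Xi22 S₁ S₂ σ δM Q Ω ξ ζ))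
    lowerᵀ
    lower
    (Matrix.fromBlocks ((-12 : ℝ) • Q) 0 0 (Xi44 S₁ S₂ δM Q Ω ξ))

end LMI

end

end PortHamiltonian

/-! Write `g(t) = ∇𝓗(ξ(t))` and `W = 𝓗 + gᵀPg`. The Lyapunov-Krasovskii functional is `V = W + δ_M
∫_{t-δ_M}^t (s - t + δ_M) g'ᵀQg' ds`. Differentiation leaves `-δ_M ∫_{t-δ_M}^t g'ᵀQg'`, which is at
most the same expression over `[ℓh, t]` with factor `t - ℓh`. The Wirtinger inequality
(`wirtinger_integral_inequality`) bounds that by a quadratic form in `g(t)`, `g(ℓh)` and the mean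
`ν` of `g` over `[ℓh, t]`. The trigger gives `eᵀΩe ≤ σ yᵀΩy` for the error in force
(`sampleError_dotProduct_le`). Adding this nonnegative slack turns the bound on `V'` into the
quadratic form of `Ξ` at `(g(t), g(ℓh), ν, e)` (`dotProduct_Xi_mulVec`), so `V' ≤ -κ‖g‖²` on a ball,
with `κ` from compactness.

The history is merely continuous, so `g'` has no meaning before `t₀`. The integrand is therefore
replaced by `0` there, and `V` decays only from the time `t₁` on at which samples taken after `t₀`
are in force (`functional_decay`). On `[t₀, t₁]`, of length at most `δ_M`, a Grönwall estimate
bounds `W + δ_M² ∫ g'ᵀQg'` by `2 exp(c δ_M)` times the bound on `W` over the history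
(`growth_bound`). Here `c` depends on `P` and `Q` only, not on the ball.

A solution whose history is so small in `W` that this bound lies below the values of `W` on a sphere
cannot cross that sphere (`norm_lt`). Near `0` such a history size exists because `W` is positive
definite; globally such a sphere exists because `𝓗 + ‖∇𝓗‖`, hence `W`, is radially unbounded.
Trapping also gives existence: the field cut off outside a ball has global solutions by the method
of steps, and these solve the true equation as they stay in the ball. Finally `V` is bounded below
and `‖g‖²` decreases at a bounded rate, so `g → 0` (`tendsto_zero_of_dissipated`), and `ξ → 0`
because `∇𝓗` vanishes in the ball at `0` only. -/

/-! ### Monotonicity and Grönwall estimates from right derivatives. -/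

theorem le_of_right_deriv_nonneg {f : ℝ → ℝ} {a b : ℝ} (hab : a ≤ b)
    (hf : ContinuousOn f (Icc a b))
    (hf' : ∀ x ∈ Ico a b, ∃ f', HasDerivWithinAt f f' (Ici x) x ∧ 0 ≤ f') : f a ≤ f b := by
  choose! f' h1 h2 using hf'
  exact image_le_of_deriv_right_le_deriv_boundary (f := fun _ => f a) (f' := fun _ => 0)
    continuousOn_const (fun x _ => hasDerivWithinAt_const x _ _) le_rfl hf h1 h2 ⟨hab, le_rfl⟩

theorem le_of_right_deriv_nonpos {f : ℝ → ℝ} {a b : ℝ} (hab : a ≤ b)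
    (hf : ContinuousOn f (Icc a b))
    (hf' : ∀ x ∈ Ico a b, ∃ f', HasDerivWithinAt f f' (Ici x) x ∧ f' ≤ 0) : f b ≤ f a := by
  have := le_of_right_deriv_nonneg (f := fun x => -f x) hab hf.neg fun x hx => by
    obtain ⟨f', h1, h2⟩ := hf' x hx
    exact ⟨-f', h1.neg, by simpa using h2⟩
  simpa using this

/-- Grönwall: `exp(-c x) f(x)` has nonpositive right derivative. No sign of `c` or `f` is needed. -/
theorem le_exp_mul_of_right_deriv_le {f : ℝ → ℝ} {a b c : ℝ} (hab : a ≤ b)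
    (hf : ContinuousOn f (Icc a b))
    (hf' : ∀ x ∈ Ico a b, ∃ f', HasDerivWithinAt f f' (Ici x) x ∧ f' ≤ c * f x) :
    f b ≤ Real.exp (c * (b - a)) * f a := by
  have he : ∀ x, HasDerivAt (fun x => Real.exp (-c * x)) (Real.exp (-c * x) * (-c)) x := fun x => by
    simpa using ((hasDerivAt_id x).const_mul (-c)).exp
  have h := le_of_right_deriv_nonpos (f := fun x => Real.exp (-c * x) * f x) hab
    (by fun_prop) (fun x hx => by
      obtain ⟨f', h1, h2⟩ := hf' x hx
      refine ⟨_, (he x).hasDerivWithinAt.mul h1, ?_⟩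
      have := mul_le_mul_of_nonneg_left h2 (Real.exp_pos (-c * x)).le
      nlinarith)
  have h2 := mul_le_mul_of_nonneg_left h (Real.exp_pos (c * b)).le
  simp only [← mul_assoc, ← Real.exp_add] at h2
  have e1 : c * b + -c * b = 0 := by ring
  have e2 : c * b + -c * a = c * (b - a) := by ring
  rwa [e1, e2, Real.exp_zero, one_mul] at h2

theorem hasDerivWithinAt_integral_Ici {E : Type*} [NormedAddCommGroup E] [NormedSpace ℝ E]
    [CompleteSpace E] {g : ℝ → E} {a b s : ℝ} (hg : ContinuousOn g (Icc a b)) (hs : s ∈ Ico a b) :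
    HasDerivWithinAt (fun u => ∫ x in a..u, g x) (g s) (Ici s) s := by
  have hsub : Icc a s ⊆ Icc a b := Icc_subset_Icc_right hs.2.le
  refine intervalIntegral.integral_hasDerivWithinAt_right (t := Ioi s)
    ((hg.mono hsub).intervalIntegrable_of_Icc hs.1) ?_ ?_
  · have hc : ContinuousOn g (Ioo s b) :=
      hg.mono fun x (hx : x ∈ Ioo s b) => ⟨hs.1.trans hx.1.le, hx.2.le⟩
    have := hc.stronglyMeasurableAtFilter_nhdsWithin measurableSet_Ioo (μ := MeasureTheory.volume) s
    rwa [nhdsWithin_Ioo_eq_nhdsGT hs.2] at this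
  · have : ContinuousWithinAt g (Ioo s b) s := (hg s ⟨hs.1, hs.2.le⟩).mono
      fun x (hx : x ∈ Ioo s b) => ⟨hs.1.trans hx.1.le, hx.2.le⟩
    rwa [ContinuousWithinAt, nhdsWithin_Ioo_eq_nhdsGT hs.2] at this

/-! ### The Wirtinger inequality and the Krasovskii functional. -/

section Krasovskii

variable {E : Type*} [NormedAddCommGroup E] [NormedSpace ℝ E]
  (B : E →L[ℝ] E →L[ℝ] ℝ)

/-- The Wirtinger-based (second order Bessel-Legendre) integral inequality for a function with
right derivative `g'`, where `Φ` is a primitive of `B g' g'`. -/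
theorem wirtinger_integral_inequality [CompleteSpace E] (hsymm : ∀ x y, B x y = B y x)
    (hpos : ∀ x, 0 ≤ B x x)
    {g g' : ℝ → E} {Φ : ℝ → ℝ} {a b : ℝ} (hab : a < b)
    (hg : ContinuousOn g (Icc a b)) (hΦ : ContinuousOn Φ (Icc a b))
    (hg' : ∀ s ∈ Ico a b, HasDerivWithinAt g (g' s) (Ici s) s)
    (hΦ' : ∀ s ∈ Ico a b, HasDerivWithinAt Φ (B (g' s) (g' s)) (Ici s) s) {ν : E}
    (hν : ∫ s in a..b, g s = (b - a) • ν) :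
    B (g b - g a) (g b - g a) + 3 * B (g b + g a - (2 : ℝ) • ν) (g b + g a - (2 : ℝ) • ν)
      ≤ (b - a) * (Φ b - Φ a) := by
  set δ := b - a with hδ
  have hδ0 : 0 < δ := sub_pos.2 hab
  set m := (a + b) / 2 with hm
  -- `c₀ + (s - m) c₁` is the `L²` projection of `g'` onto affine functions on `[a, b]`: `c₀` is the
  -- mean of `g'`, and `c₁` is `∫ (s - m) g' = (δ/2)(g b + g a - 2ν)` divided by `∫ (s - m)² =
  -- δ³/12`.
  set c₀ : E := δ⁻¹ • (g b - g a) with hc₀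
  set c₁ : E := (6 / δ ^ 2) • (g b + g a - (2 : ℝ) • ν) with hc₁
  set N : ℝ → E := fun s => ∫ x in a..s, g x with hN
  have hN' : ∀ s ∈ Ico a b, HasDerivWithinAt N (g s) (Ici s) s :=
    fun s hs => hasDerivWithinAt_integral_Ici hg hs
  have hNc : ContinuousOn N (Icc a b) := by
    have := intervalIntegral.continuousOn_primitive_interval (μ := MeasureTheory.volume) (f := g)
      (a := a) (b := b) (by rw [uIcc_of_le hab.le]; exact hg.integrableOn_Icc)
    rwa [uIcc_of_le hab.le] at this
  -- A primitive of the form of `g' - c₀ - (s - m) c₁`, so that Bessel's inequality becomes `f a ≤ f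
  -- b` and `g'` is never integrated. The term `(s - m) g - N` is a primitive of `(s - m) g'`; the
  -- cross term in `c₀, c₁` takes equal values at both ends.
  let f : ℝ → ℝ := fun s => Φ s - 2 * B c₀ (g s) - 2 * B c₁ ((s - m) • g s - N s)
    + (B c₀ c₀ * s + B c₀ c₁ * (s - m) ^ 2 + B c₁ c₁ * ((s - m) ^ 3 / 3))
  have hd : ∀ s ∈ Ico a b, HasDerivWithinAt f
      (B (g' s - c₀ - (s - m) • c₁) (g' s - c₀ - (s - m) • c₁)) (Ici s) s := by
    intro s hs
    have hid : HasDerivWithinAt (fun s : ℝ => s - m) 1 (Ici s) s :=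
      (hasDerivWithinAt_id s _).sub_const m
    have h1 := (((hΦ' s hs).sub (((B c₀).hasFDerivAt.comp_hasDerivWithinAt s
      (hg' s hs)).const_mul 2)).sub (((B c₁).hasFDerivAt.comp_hasDerivWithinAt s
      ((hid.smul (hg' s hs)).sub (hN' s hs))).const_mul 2)).add
      ((((hasDerivWithinAt_id s _).const_mul (B c₀ c₀)).add ((hid.pow 2).const_mul (B c₀ c₁))).add
        (((hid.pow 3).div_const 3).const_mul (B c₁ c₁)))
    refine h1.congr_deriv ?_
    simp only [map_sub, map_smul, map_add, sub_apply,
      smul_apply, smul_eq_mul]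
    rw [hsymm c₀ (g' s), hsymm c₁ (g' s), hsymm c₁ c₀]
    simp
    ring
  have hfc : ContinuousOn f (Icc a b) := by
    have e1 : ContinuousOn (fun s => B c₀ (g s)) (Icc a b) :=
      (B c₀).continuous.comp_continuousOn hg
    have e2 : ContinuousOn (fun s => B c₁ ((s - m) • g s - N s)) (Icc a b) :=
      (B c₁).continuous.comp_continuousOn (by fun_prop)
    simp only [f]
    fun_prop
  have key := le_of_right_deriv_nonneg hab.le hfc fun s hs => ⟨_, hd s hs, hpos _⟩
  have hNa : N a = 0 := by simp [hN]
  have hNb : N b = δ • ν := hν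
  simp only [f, hNa, hNb] at key
  have hbm : b - m = δ / 2 := by rw [hm, hδ]; ring
  have ham : a - m = -(δ / 2) := by rw [hm, hδ]; ring
  rw [hbm, ham] at key
  have e1 : B c₀ (g b) - B c₀ (g a) = δ⁻¹ * B (g b - g a) (g b - g a) := by
    rw [← map_sub, hc₀]; simp
  have e2 : B c₁ ((δ / 2) • g b - δ • ν) - B c₁ ((-(δ / 2)) • g a - 0)
      = 3 / δ * B (g b + g a - (2 : ℝ) • ν) (g b + g a - (2 : ℝ) • ν) := by
    rw [← map_sub]
    have : (δ / 2) • g b - δ • ν - ((-(δ / 2)) • g a - 0)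
        = (δ / 2) • (g b + g a - (2 : ℝ) • ν) := by module
    rw [this, hc₁]
    simp only [map_smul, smul_apply, smul_eq_mul]
    field_simp
    ring
  have e3 : B c₀ c₀ = δ⁻¹ ^ 2 * B (g b - g a) (g b - g a) := by
    rw [hc₀]; simp only [map_smul, smul_apply, smul_eq_mul]; ring
  have e4 : B c₁ c₁ = 36 / δ ^ 4 * B (g b + g a - (2 : ℝ) • ν) (g b + g a - (2 : ℝ) • ν) := by
    rw [hc₁]; simp only [map_smul, smul_apply, smul_eq_mul]; field_simp; ring
  set X := B (g b - g a) (g b - g a)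
  set Y := B (g b + g a - (2 : ℝ) • ν) (g b + g a - (2 : ℝ) • ν)
  have key2 : 0 ≤ (Φ b - Φ a) - 2 * (δ⁻¹ * X) - 2 * (3 / δ * Y) + δ⁻¹ ^ 2 * X * δ
      + 36 / δ ^ 4 * Y * (δ ^ 3 / 12) := by
    rw [← e1, ← e2, ← e3, ← e4, hδ]
    linarith
  have key3 := mul_nonneg hδ0.le key2
  have : δ * ((Φ b - Φ a) - 2 * (δ⁻¹ * X) - 2 * (3 / δ * Y) + δ⁻¹ ^ 2 * X * δ
      + 36 / δ ^ 4 * Y * (δ ^ 3 / 12)) = δ * (Φ b - Φ a) - X - 3 * Y := by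
    field_simp; ring
  linarith

/-- `g` is right differentiable at `t`, with a right continuous right derivative on which the
quadratic form of `B` is at most `C`. -/
structure IsRegularAt (C : ℝ) (g : ℝ → E) (t : ℝ) : Prop where
  diff : DifferentiableWithinAt ℝ g (Ici t) t
  cont : ContinuousWithinAt (fun s => derivWithin g (Ici s) s) (Ici t) t
  le : B (derivWithin g (Ici t) t) (derivWithin g (Ici t) t) ≤ C

/-- The quadratic form of the right derivative of `g`, cut off at `C` and extended by `0` to the
left of `t₀`. -/
noncomputable def dissipationRate (C t₀ : ℝ) (g : ℝ → E) : ℝ → ℝ :=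
  (Ici t₀).indicator fun t => min C (B (derivWithin g (Ici t) t) (derivWithin g (Ici t) t))

/-- The primitive of `dissipationRate` that vanishes at `t₀`. -/
noncomputable def dissipation (C t₀ : ℝ) (g : ℝ → E) (t : ℝ) : ℝ :=
  ∫ s in t₀..t, dissipationRate B C t₀ g s

variable {B} {C t₀ : ℝ} {g : ℝ → E}

theorem dissipationRate_nonneg (hpos : ∀ x, 0 ≤ B x x) (hC : 0 ≤ C) (t : ℝ) :
    0 ≤ dissipationRate B C t₀ g t :=
  indicator_nonneg (fun _ _ => le_min hC (hpos _)) t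

theorem dissipationRate_le (hC : 0 ≤ C) (t : ℝ) : dissipationRate B C t₀ g t ≤ C :=
  indicator_le_self' (s := Ici t₀) (f := fun _ => C) (fun _ _ => hC) t |>.trans' <|
    indicator_le_indicator (min_le_left _ _)

theorem dissipationRate_measurable [FiniteDimensional ℝ E] :
    Measurable (dissipationRate B C t₀ g) := by
  have := FiniteDimensional.complete ℝ E
  borelize E
  have h := measurable_derivWithin_Ici (F := E) g
  have hB : Continuous fun x : E => B x x := by fun_prop
  exact (measurable_const.min (hB.measurable.comp h)).indicator measurableSet_Ici

/-- This is what the cut-off at `C` buys: integrability on every interval without any regularity of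
`g`. The cut-off is inactive wherever `IsRegularAt` holds. -/
theorem dissipationRate_intervalIntegrable [FiniteDimensional ℝ E] (hpos : ∀ x, 0 ≤ B x x)
    (hC : 0 ≤ C) (a b : ℝ) :
    IntervalIntegrable (dissipationRate B C t₀ g) MeasureTheory.volume a b := by
  refine (intervalIntegrable_const (c := C)).mono_fun
    dissipationRate_measurable.aestronglyMeasurable (Eventually.of_forall fun t => ?_)
  dsimp only
  rw [Real.norm_of_nonneg (dissipationRate_nonneg hpos hC t), Real.norm_of_nonneg hC]
  exact dissipationRate_le hC t

theorem dissipation_continuous [FiniteDimensional ℝ E] (hpos : ∀ x, 0 ≤ B x x) (hC : 0 ≤ C) :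
    Continuous (dissipation B C t₀ g) :=
  intervalIntegral.continuous_primitive (dissipationRate_intervalIntegrable hpos hC) t₀

theorem dissipation_monotone [FiniteDimensional ℝ E] (hpos : ∀ x, 0 ≤ B x x) (hC : 0 ≤ C) :
    Monotone (dissipation B C t₀ g) := by
  intro a b hab
  have := intervalIntegral.integral_interval_sub_left
    (dissipationRate_intervalIntegrable (g := g) (t₀ := t₀) hpos hC t₀ b)
    (dissipationRate_intervalIntegrable (g := g) (t₀ := t₀) hpos hC t₀ a)
  have h2 := intervalIntegral.integral_nonneg (μ := MeasureTheory.volume) hab fun u _ =>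
    dissipationRate_nonneg (B := B) (g := g) (t₀ := t₀) hpos hC u
  unfold dissipation
  linarith

@[simp] theorem dissipation_self : dissipation B C t₀ g t₀ = 0 := by simp [dissipation]

theorem dissipation_of_le {t : ℝ} (ht : t ≤ t₀) : dissipation B C t₀ g t = 0 := by
  unfold dissipation
  rw [intervalIntegral.integral_symm, neg_eq_zero]
  refine intervalIntegral.integral_zero_ae ?_
  -- The indicator is that of the closed half-line, so the point `t₀` has to be discarded as a null
  -- set.
  filter_upwards [MeasureTheory.compl_mem_ae_iff.2
    (show MeasureTheory.volume {t₀} = 0 by simp)] with s hs hmem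
  rw [uIoc_of_le ht] at hmem
  exact indicator_of_notMem (fun h => hs (le_antisymm hmem.2 h)) _

theorem dissipation_nonneg [FiniteDimensional ℝ E] (hpos : ∀ x, 0 ≤ B x x) (hC : 0 ≤ C) (t : ℝ) :
    0 ≤ dissipation B C t₀ g t := by
  rcases le_total t t₀ with h | h
  · rw [dissipation_of_le h]
  · simpa using dissipation_monotone (g := g) (t₀ := t₀) hpos hC h

theorem IsRegularAt.hasDerivWithinAt_dissipation [FiniteDimensional ℝ E] (hpos : ∀ x, 0 ≤ B x x)
    (hC : 0 ≤ C) {t : ℝ} (ht : t₀ ≤ t) (h : IsRegularAt B C g t) :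
    HasDerivWithinAt (dissipation B C t₀ g)
      (B (derivWithin g (Ici t) t) (derivWithin g (Ici t) t)) (Ici t) t := by
  have hq : dissipationRate B C t₀ g t
      = B (derivWithin g (Ici t) t) (derivWithin g (Ici t) t) := by
    rw [dissipationRate, indicator_of_mem (mem_Ici.2 ht), min_eq_right h.le]
  rw [← hq]
  refine intervalIntegral.integral_hasDerivWithinAt_right (t := Ioi t)
    (dissipationRate_intervalIntegrable hpos hC _ _)
    dissipationRate_measurable.stronglyMeasurable.stronglyMeasurableAtFilter ?_
  have hB : Continuous fun x : E => B x x := by fun_prop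
  refine ContinuousWithinAt.mono (t := Ici t) ?_ Ioi_subset_Ici_self
  refine ContinuousWithinAt.congr (f := fun t =>
    min C (B (derivWithin g (Ici t) t) (derivWithin g (Ici t) t))) ?_ ?_ ?_
  · exact continuousWithinAt_const.min (hB.continuousAt.comp_continuousWithinAt h.cont)
  · intro y hy
    exact indicator_of_mem (mem_Ici.2 (ht.trans hy)) _
  · exact indicator_of_mem (mem_Ici.2 ht) _

/-- The Lyapunov-Krasovskii functional `W + δ² Φ(t) - δ ∫_{t-δ}^t Φ`, which is
`W + δ ∫_{t-δ}^t (s - t + δ) Φ'(s) ds`. -/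
noncomputable def krasovskii (B : E →L[ℝ] E →L[ℝ] ℝ) (C t₀ δ : ℝ) (g : ℝ → E) (W : ℝ → ℝ)
    (t : ℝ) : ℝ :=
  W t + δ ^ 2 * dissipation B C t₀ g t - δ * ∫ s in (t - δ)..t, dissipation B C t₀ g s

variable {δ : ℝ} {W : ℝ → ℝ}

/-- Since `Φ` is monotone, its integral over a window of length `δ` is at most `δ Φ(t)`. -/
theorem le_krasovskii [FiniteDimensional ℝ E] (hpos : ∀ x, 0 ≤ B x x) (hC : 0 ≤ C) (hδ : 0 ≤ δ)
    (t : ℝ) : W t ≤ krasovskii B C t₀ δ g W t := by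
  have h := intervalIntegral.integral_mono_on (μ := MeasureTheory.volume) (a := t - δ) (b := t)
    (by linarith)
    ((dissipation_continuous (g := g) (t₀ := t₀) hpos hC).intervalIntegrable _ _)
    (intervalIntegrable_const (c := dissipation B C t₀ g t))
    (fun s hs => dissipation_monotone hpos hC hs.2)
  simp at h
  unfold krasovskii
  nlinarith

theorem krasovskii_le [FiniteDimensional ℝ E] (hpos : ∀ x, 0 ≤ B x x) (hC : 0 ≤ C) (hδ : 0 ≤ δ)
    (t : ℝ) : krasovskii B C t₀ δ g W t ≤ W t + δ ^ 2 * dissipation B C t₀ g t := by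
  have h := intervalIntegral.integral_nonneg (μ := MeasureTheory.volume) (a := t - δ) (b := t)
    (by linarith)
    (fun s _ => dissipation_nonneg (B := B) (g := g) (t₀ := t₀) hpos hC s)
  unfold krasovskii
  nlinarith

theorem krasovskii_continuousOn [FiniteDimensional ℝ E] (hpos : ∀ x, 0 ≤ B x x) (hC : 0 ≤ C)
    {s : Set ℝ} (hW : ContinuousOn W s) : ContinuousOn (krasovskii B C t₀ δ g W) s := by
  have hΦ := dissipation_continuous (g := g) (t₀ := t₀) hpos hC
  have h1 : Continuous fun t => ∫ s in (t - δ)..t, dissipation B C t₀ g s := by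
    have hc := intervalIntegral.continuous_primitive (μ := MeasureTheory.volume)
      (fun a b => hΦ.intervalIntegrable a b) 0
    have : (fun t => ∫ s in (t - δ)..t, dissipation B C t₀ g s) = fun t =>
        (∫ s in (0)..t, dissipation B C t₀ g s) - ∫ s in (0)..(t - δ), dissipation B C t₀ g s := by
      funext t
      rw [intervalIntegral.integral_interval_sub_left] <;> exact hΦ.intervalIntegrable _ _
    rw [this]
    exact hc.sub (hc.comp (continuous_id.sub continuous_const))
  exact (hW.add (hΦ.continuousOn.const_smul (δ ^ 2))).sub (h1.continuousOn.const_smul δ)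

/-- In terms of the primitive `Φ` the window integral is differentiated by continuity of `Φ` alone,
so regularity of `g` is needed at `t` but not at `t - δ`, which may lie in the history. -/
theorem IsRegularAt.hasDerivWithinAt_krasovskii [FiniteDimensional ℝ E] (hpos : ∀ x, 0 ≤ B x x)
    (hC : 0 ≤ C) {t W' : ℝ} (ht : t₀ ≤ t) (h : IsRegularAt B C g t)
    (hW : HasDerivWithinAt W W' (Ici t) t) :
    HasDerivWithinAt (krasovskii B C t₀ δ g W)
      (W' + δ ^ 2 * B (derivWithin g (Ici t) t) (derivWithin g (Ici t) t)
        - δ * (dissipation B C t₀ g t - dissipation B C t₀ g (t - δ))) (Ici t) t := by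
  have hΦ := dissipation_continuous (g := g) (t₀ := t₀) hpos hC
  have hp : ∀ u, HasDerivAt (fun t => ∫ s in (0)..t, dissipation B C t₀ g s)
      (dissipation B C t₀ g u) u := fun u =>
    intervalIntegral.integral_hasDerivAt_right (hΦ.intervalIntegrable _ _)
      hΦ.stronglyMeasurable.stronglyMeasurableAtFilter hΦ.continuousAt
  have h1 : HasDerivAt (fun t => ∫ s in (t - δ)..t, dissipation B C t₀ g s)
      (dissipation B C t₀ g t - dissipation B C t₀ g (t - δ)) t := by
    have : (fun t => ∫ s in (t - δ)..t, dissipation B C t₀ g s) = fun t =>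
        (∫ s in (0)..t, dissipation B C t₀ g s) - ∫ s in (0)..(t - δ), dissipation B C t₀ g s := by
      funext t
      rw [intervalIntegral.integral_interval_sub_left] <;> exact hΦ.intervalIntegrable _ _
    rw [this]
    exact (hp t).sub ((hp (t - δ)).comp_sub_const t δ)
  exact (hW.add ((h.hasDerivWithinAt_dissipation hpos hC ht).const_mul _)).sub
    (h1.hasDerivWithinAt.const_mul δ)

end Krasovskii

/-! ### Uniform definiteness of matrix families and bilinear forms of matrices. -/

/-- The form attains a positive minimum on the compact product of `K` with the Euclidean unit
sphere; homogeneity extends the bound to all vectors. -/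
theorem exists_mul_dotProduct_self_le {X : Type*} [TopologicalSpace X] {ι : Type*} [Fintype ι]
    {K : Set X} (hK : IsCompact K) {M : X → Matrix ι ι ℝ} (hM : ContinuousOn M K)
    (hpos : ∀ p ∈ K, ∀ v : ι → ℝ, v ≠ 0 → 0 < v ⬝ᵥ (M p *ᵥ v)) :
    ∃ κ > 0, ∀ p ∈ K, ∀ v : ι → ℝ, κ * (v ⬝ᵥ v) ≤ v ⬝ᵥ (M p *ᵥ v) := by
  have hS : IsCompact {v : ι → ℝ | v ⬝ᵥ v = 1} := by
    refine Metric.isCompact_of_isClosed_isBounded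
      (isClosed_eq (by fun_prop) continuous_const) (isBounded_iff_forall_norm_le.2 ⟨1, ?_⟩)
    intro v hv
    refine (pi_norm_le_iff_of_nonneg zero_le_one).2 fun i => ?_
    have h1 : v i * v i ≤ v ⬝ᵥ v :=
      Finset.single_le_sum (f := fun i => v i * v i) (fun i _ => mul_self_nonneg _)
        (Finset.mem_univ i)
    rw [show v ⬝ᵥ v = 1 from hv] at h1
    exact abs_le_one_iff_mul_self_le_one.2 h1
  have hcont : ContinuousOn (fun z : X × (ι → ℝ) => z.2 ⬝ᵥ (M z.1 *ᵥ z.2))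
      (K ×ˢ {v : ι → ℝ | v ⬝ᵥ v = 1}) := by
    have h1 : ContinuousOn (fun z : X × (ι → ℝ) => M z.1) (K ×ˢ {v : ι → ℝ | v ⬝ᵥ v = 1}) :=
      hM.comp continuousOn_fst fun z hz => hz.1
    have h2 : Continuous fun y : Matrix ι ι ℝ × (ι → ℝ) => y.2 ⬝ᵥ (y.1 *ᵥ y.2) := by fun_prop
    exact h2.comp_continuousOn (h1.prodMk continuousOn_snd)
  obtain ⟨κ, hκ, h⟩ := (hK.prod hS).exists_forall_le' hcont (a := 0) (by
    rintro ⟨p, v⟩ ⟨hp, hv⟩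
    refine hpos p hp v ?_
    rintro rfl
    simp at hv)
  refine ⟨κ, hκ, fun p hp v => ?_⟩
  rcases eq_or_ne v 0 with rfl | hv
  · simp
  have hvv : 0 < v ⬝ᵥ v :=
    lt_of_le_of_ne (Finset.sum_nonneg fun i _ => mul_self_nonneg _)
      (fun h0 => hv (dotProduct_self_eq_zero.1 h0.symm))
  set r := Real.sqrt (v ⬝ᵥ v) with hr
  have hr0 : 0 < r := Real.sqrt_pos.2 hvv
  have hrr : r * r = v ⬝ᵥ v := Real.mul_self_sqrt hvv.le
  have := h ⟨p, r⁻¹ • v⟩ ⟨hp, by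
    simp only [mem_ofPred_eq, dotProduct_smul, smul_dotProduct, smul_eq_mul]
    rw [← hrr]; field_simp⟩
  simp only [Matrix.mulVec_smul, dotProduct_smul, smul_dotProduct, smul_eq_mul] at this
  have h2 := mul_le_mul_of_nonneg_left this (mul_self_nonneg r)
  have e : r * r * (r⁻¹ * (r⁻¹ * v ⬝ᵥ M p *ᵥ v)) = v ⬝ᵥ M p *ᵥ v := by field_simp
  rw [e] at h2
  rw [← hrr]; linarith

theorem Matrix.PosDef.exists_mul_dotProduct_self_le {ι : Type*} [Fintype ι] {M : Matrix ι ι ℝ}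
    (hM : M.PosDef) : ∃ κ > 0, ∀ v : ι → ℝ, κ * (v ⬝ᵥ v) ≤ v ⬝ᵥ (M *ᵥ v) := by
  obtain ⟨κ, hκ, h⟩ := _root_.exists_mul_dotProduct_self_le (K := (univ : Set Unit)) isCompact_univ
    (M := fun _ => M) continuousOn_const
    (fun _ _ v hv => by simpa using hM.dotProduct_mulVec_pos hv)
  exact ⟨κ, hκ, h () trivial⟩

/-- Positivity on the compact unit sphere is an open condition on the parameter, by the tube lemma.
-/
theorem eventually_dotProduct_mulVec_pos {X : Type*} [TopologicalSpace X] {ι : Type*} [Fintype ι]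
    {M : X → Matrix ι ι ℝ} {p : X} (hM : Continuous M)
    (hpos : ∀ v : ι → ℝ, v ≠ 0 → 0 < v ⬝ᵥ (M p *ᵥ v)) :
    ∀ᶠ p' in 𝓝 p, ∀ v : ι → ℝ, v ≠ 0 → 0 < v ⬝ᵥ (M p' *ᵥ v) := by
  have hcont : Continuous (fun z : X × (ι → ℝ) => z.2 ⬝ᵥ (M z.1 *ᵥ z.2)) := by
    have h1 : Continuous (fun z : X × (ι → ℝ) => M z.1) := hM.comp continuous_fst
    have h2 : Continuous fun y : Matrix ι ι ℝ × (ι → ℝ) => y.2 ⬝ᵥ (y.1 *ᵥ y.2) := by fun_prop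
    exact h2.comp (h1.prodMk continuous_snd)
  have h := (isCompact_sphere (0 : ι → ℝ) 1).eventually_forall_of_forall_eventually
    (x₀ := p) (P := fun p' v => 0 < v ⬝ᵥ (M p' *ᵥ v)) (fun v hv => by
      refine hcont.continuousAt.eventually (lt_mem_nhds (b := v ⬝ᵥ (M p *ᵥ v)) (hpos v ?_))
      rintro rfl
      simp at hv)
  filter_upwards [h] with p' hp' v hv
  have hn : 0 < ‖v‖ := norm_pos_iff.2 hv
  have := hp' (‖v‖⁻¹ • v) (by simp [norm_smul, hn.ne'])
  simp only [Matrix.mulVec_smul, dotProduct_smul, smul_dotProduct, smul_eq_mul] at this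
  have h1 : 0 < ‖v‖⁻¹ := inv_pos.2 hn
  exact pos_of_mul_pos_right (pos_of_mul_pos_right this h1.le) h1.le

/-- The continuous bilinear form `(x, y) ↦ xᵀ M y`. -/
noncomputable def matForm {ι : Type*} [Fintype ι] (M : Matrix ι ι ℝ) :
    EuclideanSpace ℝ ι →L[ℝ] EuclideanSpace ℝ ι →L[ℝ] ℝ :=
  LinearMap.toContinuousBilinearMap <| LinearMap.mk₂ ℝ
    (fun x y : EuclideanSpace ℝ ι => x.ofLp ⬝ᵥ (M *ᵥ y.ofLp))
    (fun x y z => by simp [add_dotProduct])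
    (fun c x y => by simp)
    (fun x y z => by simp [Matrix.mulVec_add])
    (fun c x y => by simp [Matrix.mulVec_smul])

@[simp] theorem matForm_apply {ι : Type*} [Fintype ι] (M : Matrix ι ι ℝ)
    (x y : EuclideanSpace ℝ ι) : matForm M x y = x.ofLp ⬝ᵥ (M *ᵥ y.ofLp) := rfl

theorem dotProduct_transpose_mulVec {ι κ : Type*} [Fintype ι] [Fintype κ] (M : Matrix ι κ ℝ)
    (v : κ → ℝ) (w : ι → ℝ) : v ⬝ᵥ (Mᵀ *ᵥ w) = (M *ᵥ v) ⬝ᵥ w := by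
  rw [Matrix.mulVec_transpose, dotProduct_comm, ← Matrix.dotProduct_mulVec, dotProduct_comm]

theorem dotProduct_mulVec_comm_of_isSymm {ι : Type*} [Fintype ι] {M : Matrix ι ι ℝ} (hM : Mᵀ = M)
    (v w : ι → ℝ) : v ⬝ᵥ (M *ᵥ w) = w ⬝ᵥ (M *ᵥ v) := by
  conv_lhs => rw [← hM, dotProduct_transpose_mulVec, dotProduct_comm]

theorem Matrix.PosDef.transpose_eq {ι : Type*} [Fintype ι] {M : Matrix ι ι ℝ} (hM : M.PosDef) :
    Mᵀ = M := by
  simpa [Matrix.IsHermitian] using hM.isHermitian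

theorem matForm_comm {ι : Type*} [Fintype ι] {M : Matrix ι ι ℝ} (hM : M.PosDef)
    (v w : EuclideanSpace ℝ ι) : matForm M v w = matForm M w v :=
  dotProduct_mulVec_comm_of_isSymm hM.transpose_eq _ _

theorem matForm_nonneg {ι : Type*} [Fintype ι] {M : Matrix ι ι ℝ} (hM : M.PosDef)
    (v : EuclideanSpace ℝ ι) : 0 ≤ matForm M v v := by
  simpa using hM.posSemidef.dotProduct_mulVec_nonneg v.ofLp

/-! ### The quadratic form of `Ξ`. -/

namespace PortHamiltonian

variable {n₁ n₂ m : ℕ} (S₁ : PortHamiltonian n₁ m) (S₂ : PortHamiltonian n₂ m)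

/-- The entries `-4Q`, `-2Q`, `6Q`, `-12Q` of `Ξ` are the expansion of the two Wirtinger squares.
The terms with `P` and `δM²` come from the derivative of the functional, with `v` in the role of
`g'`, and the last bracket is the slack of the trigger. -/
theorem dotProduct_Xi_mulVec (σ δM : ℝ) {P Q : Matrix (Fin n₁ ⊕ Fin n₂) (Fin n₁ ⊕ Fin n₂) ℝ}
    (Ω : Matrix (Fin m) (Fin m) ℝ) (hP : Pᵀ = P) (hQ : Qᵀ = Q) (ξ ζ : State n₁ n₂)
    (x d ν : Fin n₁ ⊕ Fin n₂ → ℝ) (e : Fin m → ℝ) {u v : Fin n₁ ⊕ Fin n₂ → ℝ}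
    {y : Fin m → ℝ}
    (hu : u = matA S₁ S₂ ξ *ᵥ x + matAd S₁ S₂ ξ *ᵥ d + matAe S₂ ξ *ᵥ e)
    (hv : v = hessian (energy S₁ S₂) ξ *ᵥ u)
    (hy : y = (matG S₁ ζ : Matrix (Fin m) (Fin n₁ ⊕ Fin n₂) ℝ) *ᵥ d) :
    Sum.elim (Sum.elim x d) (Sum.elim ν e) ⬝ᵥ
        (Xi S₁ S₂ σ δM P Q Ω ξ ζ *ᵥ Sum.elim (Sum.elim x d) (Sum.elim ν e))
      = x ⬝ᵥ u + 2 * (x ⬝ᵥ (P *ᵥ v)) + δM ^ 2 * (v ⬝ᵥ (Q *ᵥ v)) - (x - d) ⬝ᵥ (Q *ᵥ (x - d))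
        - 3 * ((x + d - (2 : ℝ) • ν) ⬝ᵥ (Q *ᵥ (x + d - (2 : ℝ) • ν)))
        + (σ * (y ⬝ᵥ (Ω *ᵥ y)) - e ⬝ᵥ (Ω *ᵥ e)) := by
  subst hv hy hu
  simp only [Xi, Xi11, Xi21, Xi22, Xi41, Xi42, Xi44]
  generalize matA S₁ S₂ ξ = A
  generalize matAd S₁ S₂ ξ = Ad
  generalize matAe S₂ ξ = Ae
  generalize (matG S₁ ζ : Matrix (Fin m) (Fin n₁ ⊕ Fin n₂) ℝ) = G
  generalize hessian (energy S₁ S₂) ξ = D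
  simp only [Matrix.fromBlocks_transpose, Matrix.fromBlocks_mulVec, Sum.elim_comp_inl,
    Sum.elim_comp_inr, sumElim_dotProduct_sumElim, Matrix.transpose_add, Matrix.transpose_sub,
    Matrix.transpose_smul, Matrix.transpose_mul, Matrix.transpose_transpose, hP, hQ,
    Matrix.add_mulVec, Matrix.sub_mulVec, Matrix.smul_mulVec, Matrix.zero_mulVec,
    dotProduct_add, dotProduct_sub, dotProduct_smul, dotProduct_zero, smul_eq_mul,
    ← Matrix.mulVec_mulVec, dotProduct_transpose_mulVec, Matrix.mulVec_add, Matrix.mulVec_sub,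
    Matrix.mulVec_smul, add_dotProduct, sub_dotProduct, smul_dotProduct]
  generalize D *ᵥ A *ᵥ x = a
  generalize D *ᵥ Ad *ᵥ d = b
  generalize D *ᵥ Ae *ᵥ e = c
  have cP := dotProduct_mulVec_comm_of_isSymm hP
  have cQ := dotProduct_mulVec_comm_of_isSymm hQ
  rw [cP a x, cP b x, cP c x, cQ b a, cQ c a, cQ c b, cQ d x, cQ ν x, cQ ν d,
    dotProduct_comm (A *ᵥ x) x, dotProduct_comm (Ad *ᵥ d) x, dotProduct_comm (Ae *ᵥ e) x]
  ring

end PortHamiltonian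

/-! ### Regularity of the coefficients, the gradient and the field. -/

section LocallyLipschitz

variable {X : Type*} [PseudoEMetricSpace X]

theorem LocallyLipschitz.mul_real {f g : X → ℝ} (hf : LocallyLipschitz f)
    (hg : LocallyLipschitz g) : LocallyLipschitz fun x => f x * g x :=
  (ContDiff.locallyLipschitz (𝕂 := ℝ) (f := fun p : ℝ × ℝ => p.1 * p.2) (by fun_prop)).comp
    (hf.prodMk hg)

theorem LocallyLipschitz.finset_sum {ι : Type*} (s : Finset ι) {E : Type*}
    [SeminormedAddCommGroup E] {f : ι → X → E} (hf : ∀ i, LocallyLipschitz (f i)) :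
    LocallyLipschitz fun x => ∑ i ∈ s, f i x := by
  classical
  induction s using Finset.induction_on with
  | empty => simpa using LocallyLipschitz.const (0 : E)
  | insert i s hi ih => simpa [Finset.sum_insert hi] using (hf i).add ih

theorem LocallyLipschitz.euclidean {ι : Type*} [Fintype ι] {f : X → EuclideanSpace ℝ ι}
    (hf : ∀ i, LocallyLipschitz fun x => f x i) : LocallyLipschitz f := by
  classical
  have : f = fun x => ∑ i, f x i • EuclideanSpace.single i (1 : ℝ) := by
    funext x
    ext j
    simp [Pi.single_apply]
  rw [this]
  refine LocallyLipschitz.finset_sum _ fun i => ?_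
  exact (ContDiff.locallyLipschitz (𝕂 := ℝ)
    (f := fun c : ℝ => c • EuclideanSpace.single i (1 : ℝ)) (by fun_prop)).comp (hf i)

end LocallyLipschitz

namespace PortHamiltonian

section Gradient

variable {ι : Type} [Fintype ι] {f : EuclideanSpace ℝ ι → ℝ}

theorem contDiff_gradient (hf : ContDiff ℝ 2 f) : ContDiff ℝ 1 (gradient f) := by
  have h := hf.fderiv_right (m := 1) (by norm_num)
  exact (InnerProductSpace.toDual ℝ (EuclideanSpace ℝ ι)).symm.contDiff.comp h

theorem gradient_apply [DecidableEq ι] (x : EuclideanSpace ℝ ι) (i : ι) :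
    gradient f x i = fderiv ℝ f x (EuclideanSpace.single i 1) := by
  rw [← toDual_gradient (f := f) (x := x), InnerProductSpace.toDual_apply_apply,
    EuclideanSpace.inner_single_right]
  simp

theorem hessian_mulVec [DecidableEq ι] (x v : EuclideanSpace ℝ ι) :
    hessian f x *ᵥ v.ofLp = (fderiv ℝ (gradient f) x v).ofLp := by
  have hv : v = ∑ j, v j • EuclideanSpace.single j (1 : ℝ) := by
    ext j
    simp [Pi.single_apply]
  ext i
  conv_rhs => rw [hv]
  simp [hessian, Matrix.mulVec, dotProduct, mul_comm]

theorem continuous_hessian [DecidableEq ι] (hf : ContDiff ℝ 2 f) : Continuous (hessian f) := by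
  refine continuous_matrix fun i j => ?_
  have h := (contDiff_gradient hf).continuous_fderiv (by norm_num)
  have h2 : Continuous fun x => fderiv ℝ (gradient f) x (EuclideanSpace.single j 1) :=
    h.clm_apply continuous_const
  exact (EuclideanSpace.proj (𝕜 := ℝ) i).continuous.comp h2

end Gradient

variable {n₁ n₂ m : ℕ} (S₁ : PortHamiltonian n₁ m) (S₂ : PortHamiltonian n₂ m)

theorem State.contDiff_fst : ContDiff ℝ 2 (State.fst : State n₁ n₂ → _) :=
  contDiff_euclidean.2 fun i =>
    show ContDiff ℝ 2 fun ξ : State n₁ n₂ => ξ (Sum.inl i) by fun_prop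

theorem State.contDiff_snd : ContDiff ℝ 2 (State.snd : State n₁ n₂ → _) :=
  contDiff_euclidean.2 fun i =>
    show ContDiff ℝ 2 fun ξ : State n₁ n₂ => ξ (Sum.inr i) by fun_prop

theorem State.locallyLipschitz_fst : LocallyLipschitz (State.fst : State n₁ n₂ → _) :=
  (State.contDiff_fst.of_le one_le_two).locallyLipschitz

theorem State.locallyLipschitz_snd : LocallyLipschitz (State.snd : State n₁ n₂ → _) :=
  (State.contDiff_snd.of_le one_le_two).locallyLipschitz

theorem contDiff_energy : ContDiff ℝ 2 (energy S₁ S₂) :=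
  (S₁.H_contDiff.comp State.contDiff_fst).add (S₂.H_contDiff.comp State.contDiff_snd)

/-- Moving along a coordinate of `x₁` leaves `H₂(x₂)` constant. -/
theorem gradient_energy_inl (ξ : State n₁ n₂) (i : Fin n₁) :
    gradient (energy S₁ S₂) ξ (Sum.inl i) = gradient S₁.H ξ.fst i := by
  rw [gradient_apply, gradient_apply]
  have h1 : HasFDerivAt S₁.H _ ξ.fst :=
    (S₁.H_contDiff.differentiable (by norm_num)).differentiableAt.hasFDerivAt
  have h2 : HasFDerivAt S₂.H _ ξ.snd :=
    (S₂.H_contDiff.differentiable (by norm_num)).differentiableAt.hasFDerivAt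
  have hl : HasDerivAt (fun t : ℝ => State.fst (ξ + t • EuclideanSpace.single (Sum.inl i) 1))
      (EuclideanSpace.single i 1) 0 := by
    have h0 : (fun t : ℝ => State.fst (ξ + t • EuclideanSpace.single (Sum.inl i) 1))
        = fun t => ξ.fst + t • EuclideanSpace.single i 1 := by
      funext t
      ext j
      simp [State.fst]
    rw [h0]
    simpa using ((hasDerivAt_id (0 : ℝ)).smul_const (EuclideanSpace.single i (1 : ℝ))).const_add
      ξ.fst
  have hr : (fun t : ℝ => State.snd (ξ + t • EuclideanSpace.single (Sum.inl i) 1))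
      = fun _ => ξ.snd := by
    funext t
    ext j
    simp [State.snd]
  have hE : HasFDerivAt (energy S₁ S₂) _ ξ :=
    ((contDiff_energy S₁ S₂).differentiable (by norm_num)).differentiableAt.hasFDerivAt
  have hline : HasDerivAt (fun t : ℝ => ξ + t • EuclideanSpace.single (Sum.inl i) (1 : ℝ))
      (EuclideanSpace.single (Sum.inl i) 1) 0 := by
    simpa using ((hasDerivAt_id (0 : ℝ)).smul_const _).const_add ξ
  have d1 := HasFDerivAt.comp_hasDerivAt (x := (0 : ℝ)) (l := energy S₁ S₂) (by simpa using hE) hline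
  have d2 := HasFDerivAt.comp_hasDerivAt (x := (0 : ℝ)) (l := S₁.H) (by simpa using h1) hl
  have d3 := d2.add_const (S₂.H ξ.snd)
  refine d1.unique (d3.congr_of_eventuallyEq (Eventually.of_forall fun t => ?_))
  have := congrFun hr t
  simp only [Function.comp, energy, this]

/-- Expresses the sampled output through the delayed gradient, so that the trigger becomes a
quadratic constraint on the vector to which `Ξ` is applied. Only the first block of the gradient
matters, as `𝒢` annihilates the second. -/
theorem output_eq (ζ : State n₁ n₂) :
    S₁.output ζ.fst = (matG S₁ ζ : Matrix (Fin m) (Fin n₁ ⊕ Fin n₂) ℝ) *ᵥ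
      (gradient (energy S₁ S₂) ζ).ofLp := by
  have : (gradient (energy S₁ S₂) ζ).ofLp = Sum.elim (gradient S₁.H ζ.fst).ofLp
      (fun j => gradient (energy S₁ S₂) ζ (Sum.inr j)) := by
    funext i
    rcases i with i | i
    · exact gradient_energy_inl S₁ S₂ ζ i
    · rfl
  rw [this, matG, Matrix.fromCols_mulVec]
  simp [output]

theorem locallyLipschitz_B (i j : Fin n₁) : LocallyLipschitz fun x => S₁.B x i j := by
  simpa [B] using (S₁.J_lipschitz i j).sub (S₁.R_lipschitz i j)

theorem locallyLipschitz_G_mul_transpose (i : Fin n₁) (j : Fin n₂) :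
    LocallyLipschitz fun ξ : State n₁ n₂ => (S₁.G ξ.fst * (S₂.G ξ.snd)ᵀ) i j := by
  simp only [Matrix.mul_apply, Matrix.transpose_apply]
  exact LocallyLipschitz.finset_sum _ fun k =>
    ((S₁.G_lipschitz i k).comp State.locallyLipschitz_fst).mul_real
      ((S₂.G_lipschitz j k).comp State.locallyLipschitz_snd)

theorem locallyLipschitz_matA (i j) : LocallyLipschitz fun ξ => matA S₁ S₂ ξ i j := by
  rcases i with i | i <;> rcases j with j | j <;> simp only [matA, Matrix.fromBlocks_apply₁₁,
    Matrix.fromBlocks_apply₁₂, Matrix.fromBlocks_apply₂₁, Matrix.fromBlocks_apply₂₂]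
  · exact (locallyLipschitz_B S₁ i j).comp State.locallyLipschitz_fst
  · exact (locallyLipschitz_G_mul_transpose S₁ S₂ i j).neg
  · exact LocallyLipschitz.const _
  · exact (locallyLipschitz_B S₂ i j).comp State.locallyLipschitz_snd

theorem locallyLipschitz_matAd (i j) : LocallyLipschitz fun ξ => matAd S₁ S₂ ξ i j := by
  rcases i with i | i <;> rcases j with j | j <;> simp only [matAd, Matrix.fromBlocks_apply₁₁,
    Matrix.fromBlocks_apply₁₂, Matrix.fromBlocks_apply₂₁, Matrix.fromBlocks_apply₂₂]
  · exact LocallyLipschitz.const _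
  · exact LocallyLipschitz.const _
  · have h := locallyLipschitz_G_mul_transpose S₁ S₂ j i
    have : ∀ ξ : State n₁ n₂, (S₂.G ξ.snd * (S₁.G ξ.fst)ᵀ) i j
        = (S₁.G ξ.fst * (S₂.G ξ.snd)ᵀ) j i := fun ξ => by
      simp [Matrix.mul_apply, mul_comm]
    simpa only [this] using h
  · exact LocallyLipschitz.const _

theorem locallyLipschitz_matAe (i j) :
    LocallyLipschitz fun ξ : State n₁ n₂ => matAe S₂ ξ i j := by
  rcases i with i | i
  · exact LocallyLipschitz.const _
  · exact (S₂.G_lipschitz i j).comp State.locallyLipschitz_snd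

theorem locallyLipschitz_matG (i j) :
    LocallyLipschitz fun ξ : State n₁ n₂ =>
      (matG S₁ ξ : Matrix (Fin m) (Fin n₁ ⊕ Fin n₂) ℝ) i j := by
  rcases j with j | j
  · exact (S₁.G_lipschitz j i).comp State.locallyLipschitz_fst
  · exact LocallyLipschitz.const _

theorem continuous_matA : Continuous (matA S₁ S₂) :=
  continuous_matrix fun i j => (locallyLipschitz_matA S₁ S₂ i j).continuous

theorem continuous_matAd : Continuous (matAd S₁ S₂) :=
  continuous_matrix fun i j => (locallyLipschitz_matAd S₁ S₂ i j).continuous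

theorem continuous_matAe : Continuous (matAe S₂ : State n₁ n₂ → _) :=
  continuous_matrix fun i j => (locallyLipschitz_matAe S₂ i j).continuous

theorem continuous_matG :
    Continuous (matG S₁ : State n₁ n₂ → Matrix (Fin m) (Fin n₁ ⊕ Fin n₂) ℝ) :=
  continuous_matrix fun i j => (locallyLipschitz_matG S₁ i j).continuous

theorem continuous_gradient_energy : Continuous (gradient (energy S₁ S₂)) :=
  (contDiff_gradient (contDiff_energy S₁ S₂)).continuous

/-- Between arrivals the sample and the error are frozen, so the delayed equation is an autonomous
ordinary differential equation with this right-hand side. -/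
theorem locallyLipschitz_field (ζ : State n₁ n₂) (e : Fin m → ℝ) :
    LocallyLipschitz fun ξ => field S₁ S₂ ξ ζ e := by
  refine LocallyLipschitz.euclidean fun i => ?_
  have hg (j) : LocallyLipschitz fun ξ => gradient (energy S₁ S₂) ξ j :=
    (ContDiff.locallyLipschitz (𝕂 := ℝ)
      (contDiff_euclidean.1 (contDiff_gradient (contDiff_energy S₁ S₂)) j))
  simp only [field, PiLp.toLp_apply, Pi.add_apply, Matrix.mulVec, dotProduct]
  exact ((LocallyLipschitz.finset_sum _ fun j =>
    (locallyLipschitz_matA S₁ S₂ i j).mul_real (hg j)).add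
    (LocallyLipschitz.finset_sum _ fun j =>
      (locallyLipschitz_matAd S₁ S₂ i j).mul_real (LocallyLipschitz.const _))).add
    (LocallyLipschitz.finset_sum _ fun j =>
      (locallyLipschitz_matAe S₂ i j).mul_real (LocallyLipschitz.const _))

theorem continuous_field :
    Continuous fun p : State n₁ n₂ × State n₁ n₂ × (Fin m → ℝ) => field S₁ S₂ p.1 p.2.1 p.2.2 := by
  have hA := (continuous_matA S₁ S₂).comp
    (continuous_fst (X := State n₁ n₂) (Y := State n₁ n₂ × (Fin m → ℝ)))
  have hAd := (continuous_matAd S₁ S₂).comp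
    (continuous_fst (X := State n₁ n₂) (Y := State n₁ n₂ × (Fin m → ℝ)))
  have hAe := (continuous_matAe (n₁ := n₁) S₂).comp
    (continuous_fst (X := State n₁ n₂) (Y := State n₁ n₂ × (Fin m → ℝ)))
  have hg := (PiLp.continuous_ofLp 2 _).comp (continuous_gradient_energy S₁ S₂)
  refine (PiLp.continuous_toLp 2 _).comp ?_
  exact ((hA.matrix_mulVec (hg.comp continuous_fst)).add
    (hAd.matrix_mulVec (hg.comp (continuous_fst.comp continuous_snd)))).add
    (hAe.matrix_mulVec (continuous_snd.comp continuous_snd))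

theorem continuous_Xi (σ δM : ℝ) (P Q : Matrix (Fin n₁ ⊕ Fin n₂) (Fin n₁ ⊕ Fin n₂) ℝ)
    (Ω : Matrix (Fin m) (Fin m) ℝ) :
    Continuous fun p : State n₁ n₂ × State n₁ n₂ => Xi S₁ S₂ σ δM P Q Ω p.1 p.2 := by
  have hA := (continuous_matA S₁ S₂).comp (continuous_fst (X := State n₁ n₂) (Y := State n₁ n₂))
  have hAd := (continuous_matAd S₁ S₂).comp (continuous_fst (X := State n₁ n₂) (Y := State n₁ n₂))
  have hAe := (continuous_matAe (n₁ := n₁) S₂).comp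
    (continuous_fst (X := State n₁ n₂) (Y := State n₁ n₂))
  have hD := (continuous_hessian (contDiff_energy S₁ S₂)).comp
    (continuous_fst (X := State n₁ n₂) (Y := State n₁ n₂))
  have hG := (continuous_matG (n₂ := n₂) S₁).comp
    (continuous_snd (X := State n₁ n₂) (Y := State n₁ n₂))
  simp only [Function.comp_def] at hA hAd hAe hD hG
  have h21 : Continuous fun p : State n₁ n₂ × State n₁ n₂ => Xi21 S₁ S₂ δM P Q p.1 := by
    simp only [Xi21]; fun_prop
  have hl : Continuous fun p : State n₁ n₂ × State n₁ n₂ =>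
      Matrix.fromBlocks ((6 : ℝ) • Q) ((6 : ℝ) • Q)
        (Xi41 S₁ S₂ δM P Q p.1) (Xi42 S₁ S₂ δM Q p.1) := by
    refine Continuous.matrix_fromBlocks continuous_const continuous_const ?_ ?_
    · simp only [Xi41]; fun_prop
    · simp only [Xi42]; fun_prop
  refine Continuous.matrix_fromBlocks (Continuous.matrix_fromBlocks ?_ h21.matrix_transpose h21 ?_)
    hl.matrix_transpose hl
    (Continuous.matrix_fromBlocks continuous_const continuous_const continuous_const ?_)
  · simp only [Xi11]; fun_prop
  · simp only [Xi22]; fun_prop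
  · simp only [Xi44]; fun_prop

end PortHamiltonian

/-! ### Existence of solutions: cut-off and method of steps. -/

/-- A bounded locally Lipschitz vector field has solutions on every compact interval. -/
theorem exists_hasDerivWithinAt_of_bounded {E : Type*} [NormedAddCommGroup E] [NormedSpace ℝ E]
    [FiniteDimensional ℝ E] {F : E → E} (hF : LocallyLipschitz F) {M : ℝ} (hM : ∀ x, ‖F x‖ ≤ M)
    (x₀ : E) {a b : ℝ} (hab : a ≤ b) :
    ∃ α : ℝ → E, α a = x₀ ∧ ∀ t ∈ Icc a b, HasDerivWithinAt α (F (α t)) (Icc a b) t := by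
  have := FiniteDimensional.complete ℝ E
  have := FiniteDimensional.proper ℝ E
  have hM0 : 0 ≤ M := (norm_nonneg _).trans (hM x₀)
  -- A curve of speed at most `M` travels no further than this in `[a, b]`, so one application of
  -- Picard-Lindelöf covers the whole interval.
  set R : NNReal := ⟨M * (b - a), mul_nonneg hM0 (sub_nonneg.2 hab)⟩ with hR
  obtain ⟨K, hK⟩ := (hF.locallyLipschitzOn
    (s := Metric.closedBall x₀ R)).exists_lipschitzOnWith_of_compact (isCompact_closedBall _ _)
  have hP : IsPicardLindelof (fun _ => F) (⟨a, le_rfl, hab⟩ : Icc a b) x₀ R 0 ⟨M, hM0⟩ K :=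
    IsPicardLindelof.of_time_independent (fun x _ => hM x) hK (by
      simp only [sub_self, NNReal.coe_zero, sub_zero]
      rw [max_eq_left (sub_nonneg.2 hab)]
      exact le_rfl)
  exact hP.exists_eq_forall_mem_Icc_hasDerivWithinAt₀

/-- A Lipschitz cutoff function: `1` on the ball of radius `ρ` and `0` off that of radius
`ρ + 1`. -/
def ballCutoff {E : Type*} [Norm E] (ρ : ℝ) (x : E) : ℝ := max 0 (min 1 (ρ + 1 - ‖x‖))

theorem ballCutoff_eq_one {E : Type*} [Norm E] {ρ : ℝ} {x : E} (hx : ‖x‖ ≤ ρ) :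
    ballCutoff ρ x = 1 := by
  rw [ballCutoff, min_eq_left (by linarith), max_eq_right zero_le_one]

theorem locallyLipschitz_ballCutoff {E : Type*} [SeminormedAddCommGroup E] (ρ : ℝ) :
    LocallyLipschitz (ballCutoff ρ : E → ℝ) :=
  (((LocallyLipschitz.const (ρ + 1)).sub lipschitzWith_one_norm.locallyLipschitz).const_min
    1).const_max 0

theorem LocallyLipschitz.exists_norm_ballCutoff_smul_le {E : Type*} [NormedAddCommGroup E]
    [NormedSpace ℝ E] [FiniteDimensional ℝ E] {F : E → E} (hF : LocallyLipschitz F) (ρ : ℝ) :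
    ∃ M, ∀ x, ‖ballCutoff ρ x • F x‖ ≤ M := by
  have := FiniteDimensional.proper ℝ E
  obtain ⟨M, hM⟩ := (isCompact_closedBall (0 : E) (ρ + 1)).exists_bound_of_continuousOn
    hF.continuous.continuousOn
  refine ⟨max M 0, fun x => ?_⟩
  rcases le_or_gt ‖x‖ (ρ + 1) with hx | hx
  · rw [norm_smul]
    have h1 : ‖ballCutoff ρ x‖ ≤ 1 := by
      rw [Real.norm_of_nonneg (show 0 ≤ ballCutoff ρ x from le_max_left _ _)]
      exact max_le zero_le_one (min_le_left _ _)
    have := hM x (by simpa using hx)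
    calc _ ≤ 1 * ‖F x‖ := by gcongr
      _ ≤ _ := by rw [one_mul]; exact this.trans (le_max_left _ _)
  · have : ballCutoff ρ x = 0 := max_eq_left ((min_le_right _ _).trans (by linarith))
    simp [this]

theorem LocallyLipschitz.ballCutoff_smul {ι : Type*} [Fintype ι]
    {F : EuclideanSpace ℝ ι → EuclideanSpace ℝ ι} (hF : LocallyLipschitz F) (ρ : ℝ) :
    LocallyLipschitz fun x => ballCutoff ρ x • F x :=
  LocallyLipschitz.euclidean fun i => by
    simp only [PiLp.smul_apply, smul_eq_mul]
    refine (locallyLipschitz_ballCutoff ρ).mul_real ?_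
    exact (ContDiff.locallyLipschitz (𝕂 := ℝ) (f := fun x : EuclideanSpace ℝ ι => x i)
      (by fun_prop)).comp hF

namespace PortHamiltonian

variable {n₁ n₂ m : ℕ} (S₁ : PortHamiltonian n₁ m)

theorem lastSent_congr {σ : ℝ} {Ω : Matrix (Fin m) (Fin m) ℝ} {w : Fin m → ℝ}
    {y y' : ℕ → Fin m → ℝ} (ℓ : ℕ) (h : ∀ k ≤ ℓ, y k = y' k) :
    lastSent σ Ω w y ℓ = lastSent σ Ω w y' ℓ := by
  induction ℓ with
  | zero => simp [lastSent, h 0 le_rfl]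
  | succ ℓ ih => simp only [lastSent, h (ℓ + 1) le_rfl, ih fun k hk => h k (hk.trans ℓ.le_succ)]

/-- Causality: the transmission decisions up to sample `ℓ` read no later sample. Hence the error is
known before the step in which it acts. -/
theorem sampleError_congr {σ h : ℝ} {Ω : Matrix (Fin m) (Fin m) ℝ} {w : Fin m → ℝ}
    {ξ ξ' : ℝ → State n₁ n₂} (ℓ : ℕ) (hξ : ∀ k : ℕ, k ≤ ℓ → ξ (k * h) = ξ' (k * h)) :
    sampleError S₁ σ h Ω w ξ ℓ = sampleError S₁ σ h Ω w ξ' ℓ := by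
  unfold sampleError
  rw [lastSent_congr ℓ (y' := fun k : ℕ => S₁.output (ξ' (k * h)).fst)
    (fun k hk => by simp only [hξ k hk]), hξ ℓ le_rfl]

theorem AdmissibleDelay.le_arrival {h τm τM : ℝ} {τ : ℝ → ℝ} (hh : 0 < h)
    (hτ : AdmissibleDelay h τm τM τ) (ℓ : ℕ) : ℓ * h + τm ≤ arrival h τ ℓ := by
  have := (hτ.2.1 (ℓ * h) (by positivity)).1
  unfold arrival; linarith

theorem AdmissibleDelay.arrival_le {h τm τM : ℝ} {τ : ℝ → ℝ} (hh : 0 < h)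
    (hτ : AdmissibleDelay h τm τM τ) (ℓ : ℕ) : arrival h τ ℓ ≤ ℓ * h + τM := by
  have := (hτ.2.1 (ℓ * h) (by positivity)).2
  unfold arrival; linarith

theorem AdmissibleDelay.lt_arrival {h τm τM : ℝ} {τ : ℝ → ℝ} (hh : 0 < h)
    (hτ : AdmissibleDelay h τm τM τ) (ℓ : ℕ) : ℓ * h < arrival h τ ℓ := by
  have := hτ.le_arrival hh ℓ
  linarith [hτ.1]

/-- Delays are positive, so the sample taken at or after `t` arrives strictly after `t`. In
particular the arrival instants exhaust the half-line. -/
theorem AdmissibleDelay.lt_arrival_ceil {h τm τM : ℝ} {τ : ℝ → ℝ} (hh : 0 < h)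
    (hτ : AdmissibleDelay h τm τM τ) (t : ℝ) : t < arrival h τ ⌈t / h⌉₊ := by
  refine lt_of_le_of_lt ?_ (hτ.lt_arrival hh _)
  have := Nat.le_ceil (t / h)
  rwa [div_le_iff₀ hh] at this

theorem AdmissibleDelay.exists_mem_Ico {h τm τM : ℝ} {τ : ℝ → ℝ} (hh : 0 < h)
    (hτ : AdmissibleDelay h τm τM τ) {t : ℝ} (ht : arrival h τ 0 ≤ t) :
    ∃ ℓ : ℕ, t ∈ Ico (arrival h τ ℓ) (arrival h τ (ℓ + 1)) := by
  classical
  have hex : ∃ k, t < arrival h τ k := ⟨_, hτ.lt_arrival_ceil hh t⟩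
  have hspec := Nat.find_spec hex
  have hmin := fun k => Nat.find_min (m := k) hex
  generalize Nat.find hex = k at hspec hmin
  cases k with
  | zero => exact absurd hspec ht.not_gt
  | succ k => exact ⟨k, not_lt.1 (hmin k k.lt_succ_self), hspec⟩

/-- Existence of solutions of the delayed sampled-data system by the method of steps, for any
right-hand side `F` for which the undelayed equations are solvable. -/
theorem exists_solution_of_steps {F : State n₁ n₂ → State n₁ n₂ → (Fin m → ℝ) → State n₁ n₂}
    (hF : ∀ ζ e x₀ (a b : ℝ), a ≤ b → ∃ α : ℝ → State n₁ n₂, α a = x₀ ∧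
      ∀ t ∈ Icc a b, HasDerivWithinAt α (F (α t) ζ e) (Icc a b) t)
    {σ h τm τM : ℝ} {Ω : Matrix (Fin m) (Fin m) ℝ} {τ : ℝ → ℝ} (hh : 0 < h) (hτM : 0 < τM)
    (hτ : AdmissibleDelay h τm τM τ) (w : Fin m → ℝ) {φ : ℝ → State n₁ n₂}
    (hφ : ContinuousOn φ (historyInterval h τM τ)) :
    ∃ ξ : ℝ → State n₁ n₂, EqOn ξ φ (historyInterval h τM τ) ∧
      ContinuousOn ξ (Ici (arrival h τ 0 - (h + τM))) ∧
      ∀ ℓ : ℕ, ∀ t ∈ Ico (arrival h τ ℓ) (arrival h τ (ℓ + 1)),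
        HasDerivWithinAt ξ (F (ξ t) (ξ (ℓ * h)) (sampleError S₁ σ h Ω w ξ ℓ)) (Ici t) t := by
  set s := arrival h τ with hs
  have hmono : Monotone s := hτ.2.2
  choose! sol hsol₀ hsol using hF
  -- Each step prolongs from `s ℓ` to `s (ℓ + 1)`. The iterate `seq ℓ` is meaningful up to `s ℓ`
  -- only; later values are never used. Coinciding arrivals give a degenerate interval, which is
  -- harmless.
  let step : ℕ → (ℝ → State n₁ n₂) → ℝ → State n₁ n₂ := fun ℓ ψ t =>
    if t ≤ s ℓ then ψ t
    else sol (ψ (ℓ * h)) (sampleError S₁ σ h Ω w ψ ℓ) (ψ (s ℓ)) (s ℓ) (s (ℓ + 1)) t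
  let seq : ℕ → ℝ → State n₁ n₂ := fun n => Nat.rec φ step n
  have hsucc : ∀ ℓ, seq (ℓ + 1) = step ℓ (seq ℓ) := fun ℓ => rfl
  have hstep_le : ∀ ℓ t, t ≤ s ℓ → seq (ℓ + 1) t = seq ℓ t := fun ℓ t ht => by
    rw [hsucc]; exact if_pos ht
  have hstep_ge : ∀ ℓ t, s ℓ ≤ t → seq (ℓ + 1) t = sol (seq ℓ (ℓ * h))
      (sampleError S₁ σ h Ω w (seq ℓ) ℓ) (seq ℓ (s ℓ)) (s ℓ) (s (ℓ + 1)) t := fun ℓ t ht => by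
    rcases ht.eq_or_lt with rfl | ht
    · rw [hstep_le ℓ _ le_rfl, hsol₀ _ _ _ _ _ (hmono ℓ.le_succ)]
    · rw [hsucc]; exact if_neg ht.not_ge
  have hstable : ∀ j k, j ≤ k → ∀ t ≤ s j, seq k t = seq j t := by
    intro j k hjk t ht
    induction k, hjk using Nat.le_induction with
    | base => rfl
    | succ k hjk ih => rw [hstep_le k t (ht.trans (hmono hjk)), ih]
  let ξ : ℝ → State n₁ n₂ := fun t => seq ⌈t / h⌉₊ t
  have hξ : ∀ k t, t ≤ s k → ξ t = seq k t := by
    intro k t ht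
    rcases le_total k ⌈t / h⌉₊ with hk | hk
    · exact hstable k _ hk t ht
    · exact (hstable _ k hk t (hτ.lt_arrival_ceil hh t).le).symm
  -- The sample used in step `ℓ` precedes `s ℓ`, so it is already final in `seq ℓ`.
  have hsample : ∀ k ℓ : ℕ, k ≤ ℓ → ξ (k * h) = seq ℓ (k * h) := fun k ℓ hk =>
    hξ ℓ _ ((hτ.lt_arrival hh k).le.trans (hmono hk))
  set c := s 0 - (h + τM) with hc
  have hcont : ∀ k, ContinuousOn (seq k) (Icc c (s k)) := by
    intro k
    induction k with
    | zero => exact hφ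
    | succ k ih =>
      have hck : c ≤ s k := by have := hmono k.zero_le; linarith
      rw [← Icc_union_Icc_eq_Icc hck (hmono k.le_succ)]
      refine ContinuousOn.union_of_isClosed (ih.congr fun t ht => hstep_le k t ht.2) ?_
        isClosed_Icc isClosed_Icc
      have h1 := fun t ht => (hsol (seq k (k * h)) (sampleError S₁ σ h Ω w (seq k) k)
        (seq k (s k)) (s k) (s (k + 1)) (hmono k.le_succ) t ht).continuousWithinAt
      exact ContinuousOn.congr h1 fun t ht => hstep_ge k t ht.1
  refine ⟨ξ, fun t ht => hξ 0 t ht.2, fun t ht => ?_, fun ℓ t ht => ?_⟩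
  · have hlt := hτ.lt_arrival_ceil hh t
    have h1 := hcont ⌈t / h⌉₊ t ⟨ht, hlt.le⟩
    have h2 : ContinuousWithinAt ξ (Icc c (s ⌈t / h⌉₊)) t :=
      h1.congr (fun u hu => hξ _ u hu.2) (hξ _ t hlt.le)
    refine h2.mono_of_mem_nhdsWithin ?_
    rw [← Ici_inter_Iic]
    exact inter_mem_nhdsWithin _ (Iic_mem_nhds hlt)
  · have hα := (hsol (seq ℓ (ℓ * h)) (sampleError S₁ σ h Ω w (seq ℓ) ℓ)
        (seq ℓ (s ℓ)) (s ℓ) (s (ℓ + 1)) (hmono ℓ.le_succ) t ⟨ht.1, ht.2.le⟩)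
    have hIcc : ∀ u ∈ Icc (s ℓ) (s (ℓ + 1)), ξ u = sol (seq ℓ (ℓ * h))
        (sampleError S₁ σ h Ω w (seq ℓ) ℓ) (seq ℓ (s ℓ)) (s ℓ) (s (ℓ + 1)) u := fun u hu => by
      rw [hξ (ℓ + 1) u hu.2, hstep_ge ℓ u hu.1]
    have h2 := hα.congr hIcc (hIcc t ⟨ht.1, ht.2.le⟩)
    rw [hsample ℓ ℓ le_rfl, sampleError_congr S₁ ℓ (ξ' := seq ℓ) fun k hk => hsample k ℓ hk,
      hIcc t ⟨ht.1, ht.2.le⟩]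
    refine h2.mono_of_mem_nhdsWithin ?_
    exact mem_of_superset (Icc_mem_nhdsGE ht.2) (Icc_subset_Icc_left ht.1)

/-- `ξ` satisfies the delayed equation at all times at which it lies in the ball of radius `ρ`. -/
def IsSolutionInBall (S₁ : PortHamiltonian n₁ m) (S₂ : PortHamiltonian n₂ m) (σ h τM : ℝ)
    (Ω : Matrix (Fin m) (Fin m) ℝ) (τ : ℝ → ℝ) (w : Fin m → ℝ) (ρ : ℝ)
    (ξ : ℝ → State n₁ n₂) : Prop :=
  ContinuousOn ξ (Ici (arrival h τ 0 - (h + τM))) ∧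
    ∀ ℓ : ℕ, ∀ t ∈ Ico (arrival h τ ℓ) (arrival h τ (ℓ + 1)), ‖ξ t‖ < ρ →
      HasDerivWithinAt ξ (field S₁ S₂ (ξ t) (ξ (ℓ * h)) (sampleError S₁ σ h Ω w ξ ℓ)) (Ici t) t

variable {S₁} {S₂ : PortHamiltonian n₂ m} {σ h τm τM : ℝ} {Ω : Matrix (Fin m) (Fin m) ℝ}
  {τ : ℝ → ℝ} {w : Fin m → ℝ} {ρ : ℝ} {ξ : ℝ → State n₁ n₂}

theorem IsSolution.isSolutionInBall (hξ : IsSolution S₁ S₂ σ h τM Ω τ w ξ) (ρ : ℝ) :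
    IsSolutionInBall S₁ S₂ σ h τM Ω τ w ρ ξ :=
  ⟨hξ.1, fun ℓ t ht _ => hξ.2 ℓ t ht⟩

theorem IsSolutionInBall.isSolution (hξ : IsSolutionInBall S₁ S₂ σ h τM Ω τ w ρ ξ)
    (hτ : AdmissibleDelay h τm τM τ)
    (hρ : ∀ t ≥ arrival h τ 0, ‖ξ t‖ < ρ) : IsSolution S₁ S₂ σ h τM Ω τ w ξ :=
  ⟨hξ.1, fun ℓ t ht => hξ.2 ℓ t ht (hρ t ((hτ.2.2 ℓ.zero_le).trans ht.1))⟩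

theorem exists_isSolutionInBall (S₁ : PortHamiltonian n₁ m) (S₂ : PortHamiltonian n₂ m)
    (hh : 0 < h) (hτM : 0 < τM) (hτ : AdmissibleDelay h τm τM τ) (w : Fin m → ℝ) (ρ : ℝ)
    {φ : ℝ → State n₁ n₂} (hφ : ContinuousOn φ (historyInterval h τM τ)) :
    ∃ ξ : ℝ → State n₁ n₂, EqOn ξ φ (historyInterval h τM τ) ∧
      IsSolutionInBall S₁ S₂ σ h τM Ω τ w ρ ξ := by
  obtain ⟨ξ, h1, h2, h3⟩ := exists_solution_of_steps S₁ (σ := σ) (Ω := Ω)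
    (F := fun ξ ζ e => ballCutoff ρ ξ • field S₁ S₂ ξ ζ e) (fun ζ e x₀ a b hab => by
      have hl := locallyLipschitz_field S₁ S₂ ζ e
      obtain ⟨M, hM⟩ := hl.exists_norm_ballCutoff_smul_le ρ
      exact exists_hasDerivWithinAt_of_bounded (hl.ballCutoff_smul ρ) hM x₀ hab) hh hτM hτ w hφ
  refine ⟨ξ, h1, h2, fun ℓ t ht hlt => ?_⟩
  have := h3 ℓ t ht
  rwa [ballCutoff_eq_one hlt.le, one_smul] at this

end PortHamiltonian

/-! ### The dissipation inequality and derivatives along trajectories. -/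

theorem euclidean_ofLp_dotProduct_self {ι : Type*} [Fintype ι] (x : EuclideanSpace ℝ ι) :
    x.ofLp ⬝ᵥ x.ofLp = ‖x‖ ^ 2 := by
  rw [EuclideanSpace.real_norm_sq_eq]
  simp [dotProduct, sq]

theorem matForm_le {ι : Type*} [Fintype ι] (M : Matrix ι ι ℝ) (x : EuclideanSpace ℝ ι) :
    matForm M x x ≤ ‖matForm M‖ * ‖x‖ ^ 2 := by
  have h1 := (le_abs_self _).trans ((matForm M x).le_opNorm x)
  have h2 := mul_le_mul_of_nonneg_right ((matForm M).le_opNorm x) (norm_nonneg x)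
  nlinarith

/-- Supplies the Grönwall exponent. It depends on `P` and `Q` alone, so the growth factor is fixed
before any radius is chosen. -/
theorem Matrix.PosDef.exists_matForm_le {ι : Type*} [Fintype ι] {P : Matrix ι ι ℝ} (hP : P.PosDef)
    (Q : Matrix ι ι ℝ) : ∃ c ≥ 0, ∀ x, 2 * matForm Q x x ≤ c * matForm P x x := by
  obtain ⟨κ, hκ, h⟩ := hP.exists_mul_dotProduct_self_le
  refine ⟨2 * ‖matForm Q‖ / κ, by positivity, fun x => ?_⟩
  have h1 := h x.ofLp
  rw [euclidean_ofLp_dotProduct_self] at h1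
  have h2 := matForm_le Q x
  have h3 := mul_le_mul_of_nonneg_left h1 (show 0 ≤ 2 * ‖matForm Q‖ / κ by positivity)
  have e : 2 * ‖matForm Q‖ / κ * (κ * ‖x‖ ^ 2) = 2 * (‖matForm Q‖ * ‖x‖ ^ 2) := by field_simp
  rw [matForm_apply P]
  linarith

theorem matForm_sub_le {ι : Type*} [Fintype ι] {Q : Matrix ι ι ℝ} (hQ : Q.PosDef)
    (x y : EuclideanSpace ℝ ι) :
    matForm Q (x - y) (x - y) ≤ 2 * matForm Q x x + 2 * matForm Q y y := by
  have h := matForm_nonneg hQ (x + y)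
  have hc := matForm_comm hQ x y
  simp only [map_add, map_sub, add_apply, sub_apply] at h ⊢
  linarith

namespace PortHamiltonian

variable {n₁ n₂ m : ℕ} (S₁ : PortHamiltonian n₁ m) (S₂ : PortHamiltonian n₂ m)

/-- Either the sample is transmitted and the error is zero, or the trigger condition fails, which is
the bound itself. This covers the first sample too, so the stored value `w` never enters the
estimates. -/
theorem sampleError_dotProduct_le {σ : ℝ} (hσ : 0 < σ) (h : ℝ) {Ω : Matrix (Fin m) (Fin m) ℝ}
    (hΩ : Ω.PosDef) (w : Fin m → ℝ) (ξ : ℝ → State n₁ n₂) (ℓ : ℕ) :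
    sampleError S₁ σ h Ω w ξ ℓ ⬝ᵥ (Ω *ᵥ sampleError S₁ σ h Ω w ξ ℓ)
      ≤ σ * (S₁.output (ξ (ℓ * h)).fst ⬝ᵥ (Ω *ᵥ S₁.output (ξ (ℓ * h)).fst)) := by
  have hpos : ∀ y : Fin m → ℝ, 0 ≤ σ * (y ⬝ᵥ (Ω *ᵥ y)) := fun y => by
    have := hΩ.posSemidef.dotProduct_mulVec_nonneg y
    simp only [star_trivial] at this
    positivity
  unfold sampleError
  cases ℓ with
  | zero =>
    simp only [lastSent]
    split_ifs with hc
    · simpa using hpos (S₁.output (ξ ((0 : ℕ) * h)).fst)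
    · rw [not_le, eventFun] at hc
      linarith
  | succ ℓ =>
    simp only [lastSent]
    split_ifs with hc
    · simpa using hpos (S₁.output (ξ ((ℓ + 1 : ℕ) * h)).fst)
    · rw [not_le, eventFun] at hc
      linarith

/-- The delay-free part `𝓗 + ∇𝓗ᵀ P ∇𝓗` of the Lyapunov-Krasovskii functional. -/
noncomputable def lyapunov (P : Matrix (Fin n₁ ⊕ Fin n₂) (Fin n₁ ⊕ Fin n₂) ℝ)
    (ξ : State n₁ n₂) : ℝ :=
  energy S₁ S₂ ξ + matForm P (gradient (energy S₁ S₂) ξ) (gradient (energy S₁ S₂) ξ)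

/-- The value of `d/dt ∇𝓗(ξ(t))` along the delayed equation. -/
noncomputable def gradientRate (ξ ζ : State n₁ n₂) (e : Fin m → ℝ) : State n₁ n₂ :=
  fderiv ℝ (gradient (energy S₁ S₂)) ξ (field S₁ S₂ ξ ζ e)

theorem continuous_gradientRate :
    Continuous fun p : State n₁ n₂ × State n₁ n₂ × (Fin m → ℝ) =>
      gradientRate S₁ S₂ p.1 p.2.1 p.2.2 :=
  (((contDiff_gradient (contDiff_energy S₁ S₂)).continuous_fderiv (by norm_num)).comp
    continuous_fst).clm_apply (continuous_field S₁ S₂)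

theorem continuous_gradientRate_left (ζ : State n₁ n₂) (e : Fin m → ℝ) :
    Continuous fun ξ => gradientRate S₁ S₂ ξ ζ e := by
  have h : Continuous fun ξ : State n₁ n₂ => (ξ, ζ, e) := by fun_prop
  exact (continuous_gradientRate S₁ S₂).comp h

theorem continuous_lyapunov (P : Matrix (Fin n₁ ⊕ Fin n₂) (Fin n₁ ⊕ Fin n₂) ℝ) :
    Continuous (lyapunov S₁ S₂ P) := by
  have h1 := (contDiff_energy S₁ S₂).continuous
  have h2 := continuous_gradient_energy S₁ S₂
  unfold lyapunov
  fun_prop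

/-- Quantitative form of the assumptions of the theorem on a ball. -/
structure DissipativeBall (σ δM : ℝ) (P Q : Matrix (Fin n₁ ⊕ Fin n₂) (Fin n₁ ⊕ Fin n₂) ℝ)
    (Ω : Matrix (Fin m) (Fin m) ℝ) (ρ κ c L : ℝ) : Prop where
  energy_nonneg : ∀ ξ : State n₁ n₂, ‖ξ‖ ≤ ρ → 0 ≤ energy S₁ S₂ ξ
  κ_pos : 0 < κ
  dotProduct_Xi_le : ∀ ξ ζ : State n₁ n₂, ‖ξ‖ ≤ ρ → ‖ζ‖ ≤ ρ → ∀ v,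
    v ⬝ᵥ (Xi S₁ S₂ σ δM P Q Ω ξ ζ *ᵥ v) ≤ -(κ * (v ⬝ᵥ v))
  c_nonneg : 0 ≤ c
  matForm_le : ∀ x, 2 * matForm Q x x ≤ c * matForm P x x
  norm_gradientRate_le : ∀ ξ ζ : State n₁ n₂, ‖ξ‖ ≤ ρ → ‖ζ‖ ≤ ρ → ∀ e : Fin m → ℝ,
    e ⬝ᵥ (Ω *ᵥ e) ≤ σ * (S₁.output ζ.fst ⬝ᵥ (Ω *ᵥ S₁.output ζ.fst)) →
      ‖gradientRate S₁ S₂ ξ ζ e‖ ≤ L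

/-- On the ball the sampled output is bounded, the trigger bounds `e` by it, and the rate is
continuous on the resulting compact set. -/
theorem exists_norm_gradientRate_le (σ : ℝ) {Ω : Matrix (Fin m) (Fin m) ℝ} (hΩ : Ω.PosDef) (ρ : ℝ) :
    ∃ L, ∀ ξ ζ : State n₁ n₂, ‖ξ‖ ≤ ρ → ‖ζ‖ ≤ ρ → ∀ e : Fin m → ℝ,
      e ⬝ᵥ (Ω *ᵥ e) ≤ σ * (S₁.output ζ.fst ⬝ᵥ (Ω *ᵥ S₁.output ζ.fst)) →
        ‖gradientRate S₁ S₂ ξ ζ e‖ ≤ L := by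
  obtain ⟨κ, hκ, hκΩ⟩ := hΩ.exists_mul_dotProduct_self_le
  have hy : Continuous fun ζ : State n₁ n₂ => S₁.output ζ.fst := by
    simp only [output_eq S₁ S₂]
    exact (continuous_matG S₁).matrix_mulVec
      ((PiLp.continuous_ofLp 2 _).comp (continuous_gradient_energy S₁ S₂))
  have hyc : Continuous fun ζ : State n₁ n₂ =>
      σ * (S₁.output ζ.fst ⬝ᵥ (Ω *ᵥ S₁.output ζ.fst)) := by fun_prop
  obtain ⟨Y, hY⟩ := (isCompact_closedBall (0 : State n₁ n₂) ρ).exists_bound_of_continuousOn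
    hyc.continuousOn
  obtain ⟨L, hL⟩ := ((isCompact_closedBall (0 : State n₁ n₂) ρ).prod
    ((isCompact_closedBall (0 : State n₁ n₂) ρ).prod
      (isCompact_closedBall (0 : Fin m → ℝ) (Real.sqrt (Y / κ))))).exists_bound_of_continuousOn
    (continuous_gradientRate S₁ S₂).continuousOn
  refine ⟨L, fun ξ ζ hξ hζ e he => hL (ξ, ζ, e) ⟨by simpa using hξ, by simpa using hζ, ?_⟩⟩
  have h1 := (hκΩ e).trans (he.trans ((le_abs_self _).trans (hY ζ (by simpa using hζ))))
  simp only [mem_closedBall_zero_iff]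
  refine (pi_norm_le_iff_of_nonneg (Real.sqrt_nonneg _)).2 fun i => Real.abs_le_sqrt ?_
  rw [le_div_iff₀ hκ]
  have h2 : e i * e i ≤ e ⬝ᵥ e :=
    Finset.single_le_sum (f := fun i => e i * e i) (fun i _ => mul_self_nonneg _)
      (Finset.mem_univ i)
  nlinarith

theorem exists_dissipativeBall {σ δM : ℝ} {P Q : Matrix (Fin n₁ ⊕ Fin n₂) (Fin n₁ ⊕ Fin n₂) ℝ}
    {Ω : Matrix (Fin m) (Fin m) ℝ} (hΩ : Ω.PosDef) {c : ℝ} (hc : 0 ≤ c)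
    (hPQ : ∀ x, 2 * matForm Q x x ≤ c * matForm P x x) {ρ : ℝ}
    (hH : ∀ ξ : State n₁ n₂, ‖ξ‖ ≤ ρ → 0 ≤ energy S₁ S₂ ξ)
    (hXi : ∀ ξ ζ : State n₁ n₂, ‖ξ‖ ≤ ρ → ‖ζ‖ ≤ ρ → ∀ v, v ≠ 0 →
      0 < v ⬝ᵥ (-Xi S₁ S₂ σ δM P Q Ω ξ ζ *ᵥ v)) :
    ∃ κ L, DissipativeBall S₁ S₂ σ δM P Q Ω ρ κ c L := by
  obtain ⟨L, hL⟩ := exists_norm_gradientRate_le S₁ S₂ σ hΩ ρ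
  obtain ⟨κ, hκ, h⟩ := exists_mul_dotProduct_self_le
    ((isCompact_closedBall (0 : State n₁ n₂) ρ).prod (isCompact_closedBall (0 : State n₁ n₂) ρ))
    (M := fun p => -Xi S₁ S₂ σ δM P Q Ω p.1 p.2)
    (continuous_Xi S₁ S₂ σ δM P Q Ω).neg.continuousOn
    (fun p hp => hXi _ _ (by simpa using hp.1) (by simpa using hp.2))
  refine ⟨κ, L, hH, hκ, fun ξ ζ hξ hζ v => ?_, hc, hPQ, hL⟩
  have := h (ξ, ζ) ⟨by simpa using hξ, by simpa using hζ⟩ v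
  simp only [Matrix.neg_mulVec, dotProduct_neg] at this
  linarith

variable {S₁ S₂} {σ h τm τM : ℝ} {P Q : Matrix (Fin n₁ ⊕ Fin n₂) (Fin n₁ ⊕ Fin n₂) ℝ}
  {Ω : Matrix (Fin m) (Fin m) ℝ} {τ : ℝ → ℝ} {w : Fin m → ℝ} {ρ κ c L δM : ℝ}
  {ξ : ℝ → State n₁ n₂}

theorem DissipativeBall.lyapunov_nonneg (hD : DissipativeBall S₁ S₂ σ δM P Q Ω ρ κ c L)
    (hP : P.PosDef) {ζ : State n₁ n₂} (hζ : ‖ζ‖ ≤ ρ) : 0 ≤ lyapunov S₁ S₂ P ζ :=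
  add_nonneg (hD.energy_nonneg ζ hζ) (matForm_nonneg hP _)

/-- The dissipation inequality: `x` and `d` are the gradients of the energy at the current and the
delayed state, and `ν` is arbitrary. -/
theorem DissipativeBall.dissipation_inequality (hD : DissipativeBall S₁ S₂ σ δM P Q Ω ρ κ c L)
    (hP : P.PosDef) (hQ : Q.PosDef) {x ζ : State n₁ n₂} (hx : ‖x‖ ≤ ρ) (hζ : ‖ζ‖ ≤ ρ)
    {e : Fin m → ℝ}
    (he : e ⬝ᵥ (Ω *ᵥ e) ≤ σ * (S₁.output ζ.fst ⬝ᵥ (Ω *ᵥ S₁.output ζ.fst)))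
    (ν : State n₁ n₂) :
    inner ℝ (gradient (energy S₁ S₂) x) (field S₁ S₂ x ζ e)
        + 2 * matForm P (gradient (energy S₁ S₂) x) (gradientRate S₁ S₂ x ζ e)
        + δM ^ 2 * matForm Q (gradientRate S₁ S₂ x ζ e) (gradientRate S₁ S₂ x ζ e)
      ≤ matForm Q (gradient (energy S₁ S₂) x - gradient (energy S₁ S₂) ζ)
          (gradient (energy S₁ S₂) x - gradient (energy S₁ S₂) ζ)
        + 3 * matForm Q (gradient (energy S₁ S₂) x + gradient (energy S₁ S₂) ζ - (2 : ℝ) • ν)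
          (gradient (energy S₁ S₂) x + gradient (energy S₁ S₂) ζ - (2 : ℝ) • ν)
        - κ * ‖gradient (energy S₁ S₂) x‖ ^ 2 := by
  set g := gradient (energy S₁ S₂) with hg
  have h1 := hD.dotProduct_Xi_le x ζ hx hζ
    (Sum.elim (Sum.elim (g x).ofLp (g ζ).ofLp) (Sum.elim ν.ofLp e))
  rw [dotProduct_Xi_mulVec S₁ S₂ σ δM Ω hP.transpose_eq hQ.transpose_eq x ζ (g x).ofLp (g ζ).ofLp
    ν.ofLp e (u := (field S₁ S₂ x ζ e).ofLp) (v := (gradientRate S₁ S₂ x ζ e).ofLp)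
    (y := S₁.output ζ.fst) rfl (hessian_mulVec _ _).symm (output_eq S₁ S₂ ζ)] at h1
  have h2 : ‖g x‖ ^ 2 ≤ Sum.elim (Sum.elim (g x).ofLp (g ζ).ofLp) (Sum.elim ν.ofLp e) ⬝ᵥ
      Sum.elim (Sum.elim (g x).ofLp (g ζ).ofLp) (Sum.elim ν.ofLp e) := by
    simp only [sumElim_dotProduct_sumElim, euclidean_ofLp_dotProduct_self]
    have : 0 ≤ e ⬝ᵥ e := Finset.sum_nonneg fun i _ => mul_self_nonneg _
    nlinarith [sq_nonneg ‖g ζ‖, sq_nonneg ‖ν‖]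
  have h3 := mul_le_mul_of_nonneg_left h2 hD.κ_pos.le
  have h4 : inner ℝ (g x) (field S₁ S₂ x ζ e) = (g x).ofLp ⬝ᵥ (field S₁ S₂ x ζ e).ofLp := by
    rw [EuclideanSpace.inner_eq_star_dotProduct]
    simp [dotProduct_comm]
  rw [h4]
  simp only [matForm_apply, WithLp.ofLp_sub, WithLp.ofLp_add, WithLp.ofLp_smul]
  linarith

theorem IsSolutionInBall.hasDerivWithinAt_gradient
    (hξ : IsSolutionInBall S₁ S₂ σ h τM Ω τ w ρ ξ) {ℓ : ℕ} {t : ℝ}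
    (ht : t ∈ Ico (arrival h τ ℓ) (arrival h τ (ℓ + 1))) (hρ : ‖ξ t‖ < ρ) :
    HasDerivWithinAt (fun s => gradient (energy S₁ S₂) (ξ s))
      (gradientRate S₁ S₂ (ξ t) (ξ (ℓ * h)) (sampleError S₁ σ h Ω w ξ ℓ)) (Ici t) t :=
  ((contDiff_gradient (contDiff_energy S₁ S₂)).differentiable
    (by norm_num)).differentiableAt.hasFDerivAt.comp_hasDerivWithinAt t (hξ.2 ℓ t ht hρ)

theorem derivWithin_Ici_eq {E : Type*} [NormedAddCommGroup E] [NormedSpace ℝ E] {g : ℝ → E} {g' : E}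
    {t : ℝ} (hg : HasDerivWithinAt g g' (Ici t) t) : derivWithin g (Ici t) t = g' :=
  hg.derivWithin (uniqueDiffOn_Ici t t (mem_Ici.2 le_rfl))

theorem IsSolutionInBall.hasDerivWithinAt_lyapunov (hP : P.PosDef)
    (hξ : IsSolutionInBall S₁ S₂ σ h τM Ω τ w ρ ξ) {ℓ : ℕ} {t : ℝ}
    (ht : t ∈ Ico (arrival h τ ℓ) (arrival h τ (ℓ + 1))) (hρ : ‖ξ t‖ < ρ) :
    HasDerivWithinAt (fun s => lyapunov S₁ S₂ P (ξ s))
      (inner ℝ (gradient (energy S₁ S₂) (ξ t))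
          (field S₁ S₂ (ξ t) (ξ (ℓ * h)) (sampleError S₁ σ h Ω w ξ ℓ))
        + 2 * matForm P (gradient (energy S₁ S₂) (ξ t))
          (gradientRate S₁ S₂ (ξ t) (ξ (ℓ * h)) (sampleError S₁ σ h Ω w ξ ℓ))) (Ici t) t := by
  have hg := hξ.hasDerivWithinAt_gradient ht hρ
  have h1 := ((contDiff_energy S₁ S₂).differentiable
    (by norm_num)).differentiableAt.hasFDerivAt.comp_hasDerivWithinAt t (hξ.2 ℓ t ht hρ)
  rw [← toDual_gradient, InnerProductSpace.toDual_apply_apply] at h1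
  refine (h1.add ((matForm P).hasDerivWithinAt_of_bilinear hg hg)).congr_deriv ?_
  rw [matForm_comm hP (gradientRate _ _ _ _ _)]
  ring

/-- Up to the next arrival the right derivative of the gradient is a continuous function of `ξ`
alone. The bound `L` on that rate makes the cut-off `‖Q‖ L²` inactive. -/
theorem IsSolutionInBall.isRegularAt (hD : DissipativeBall S₁ S₂ σ δM P Q Ω ρ κ c L)
    (hσ : 0 < σ) (hΩ : Ω.PosDef)
    (hξ : IsSolutionInBall S₁ S₂ σ h τM Ω τ w ρ ξ) {ℓ : ℕ} {t : ℝ}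
    (ht : t ∈ Ico (arrival h τ ℓ) (arrival h τ (ℓ + 1))) (hρ : ‖ξ t‖ < ρ)
    (hρ' : ‖ξ (ℓ * h)‖ ≤ ρ) :
    IsRegularAt (matForm Q) (‖matForm Q‖ * L ^ 2)
      (fun s => gradient (energy S₁ S₂) (ξ s)) t := by
  have hg := hξ.hasDerivWithinAt_gradient ht hρ
  have hc : ContinuousWithinAt ξ (Ici t) t := (hξ.2 ℓ t ht hρ).continuousWithinAt
  refine ⟨hg.differentiableWithinAt, ?_, ?_⟩
  · have h1 : ContinuousWithinAt (fun s =>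
        gradientRate S₁ S₂ (ξ s) (ξ (ℓ * h)) (sampleError S₁ σ h Ω w ξ ℓ)) (Ici t) t :=
      (continuous_gradientRate_left S₁ S₂ _ _).continuousAt.comp_continuousWithinAt hc
    refine h1.congr_of_eventuallyEq ?_ (derivWithin_Ici_eq hg)
    have h2 : ∀ᶠ s in 𝓝[≥] t, ‖ξ s‖ < ρ := hc.norm.eventually (gt_mem_nhds hρ)
    filter_upwards [h2, Ico_mem_nhdsGE ht.2] with s hs hs'
    exact derivWithin_Ici_eq (hξ.hasDerivWithinAt_gradient ⟨ht.1.trans hs'.1, hs'.2⟩ hs)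
  · rw [derivWithin_Ici_eq hg]
    refine (_root_.matForm_le Q _).trans ?_
    have := hD.norm_gradientRate_le _ _ hρ.le hρ' _ (sampleError_dotProduct_le S₁ hσ h hΩ w ξ ℓ)
    gcongr

end PortHamiltonian

/-! ### Decay, initial growth and trapping in a ball. -/

theorem exists_first_exit {f : ℝ → ℝ} {a b ρ : ℝ} (hab : a ≤ b) (hf : ContinuousOn f (Icc a b))
    (ha : f a < ρ) (hb : ρ ≤ f b) : ∃ T ∈ Ioc a b, f T = ρ ∧ ∀ t ∈ Ico a T, f t < ρ := by
  set s := {t ∈ Icc a b | ρ ≤ f t} with hs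
  have hcl : IsClosed s := hf.preimage_isClosed_of_isClosed isClosed_Icc isClosed_Ici
  have hne : s.Nonempty := ⟨b, ⟨hab, le_rfl⟩, hb⟩
  have hbdd : BddBelow s := ⟨a, fun t ht => ht.1.1⟩
  have hT : sInf s ∈ s := hcl.csInf_mem hne hbdd
  set T := sInf s
  have hlt : ∀ t ∈ Ico a T, f t < ρ := fun t ht => by
    by_contra hcon
    exact (csInf_le hbdd ⟨⟨ht.1, ht.2.le.trans hT.1.2⟩, not_lt.1 hcon⟩).not_gt ht.2
  have haT : a < T := lt_of_le_of_ne hT.1.1 fun h => by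
    have := hT.2
    rw [← h] at this
    exact this.not_gt ha
  refine ⟨T, ⟨haT, hT.1.2⟩, le_antisymm ?_ hT.2, hlt⟩
  have hc : ContinuousWithinAt f (Ico a T) T :=
    (hf T hT.1).mono fun x (hx : x ∈ Ico a T) => ⟨hx.1, hx.2.le.trans hT.1.2⟩
  have hcl : T ∈ closure (Ico a T) := by
    rw [closure_Ico haT.ne]; exact ⟨haT.le, le_rfl⟩
  exact hc.closure_le hcl continuousWithinAt_const fun t ht => (hlt t ht).le

namespace PortHamiltonian

variable {n₁ n₂ m : ℕ} {S₁ : PortHamiltonian n₁ m} {S₂ : PortHamiltonian n₂ m}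
  {σ h τm τM : ℝ} {P Q : Matrix (Fin n₁ ⊕ Fin n₂) (Fin n₁ ⊕ Fin n₂) ℝ}
  {Ω : Matrix (Fin m) (Fin m) ℝ} {τ : ℝ → ℝ} {w : Fin m → ℝ} {ρ κ c L T : ℝ}
  {ξ : ℝ → State n₁ n₂}

theorem AdmissibleDelay.history_le_sample (hh : 0 < h) (hτ : AdmissibleDelay h τm τM τ) (ℓ : ℕ) :
    arrival h τ 0 - (h + τM) ≤ ℓ * h := by
  have h1 := hτ.arrival_le hh 0
  have h2 : 0 ≤ (ℓ : ℝ) * h := by positivity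
  simp only [Nat.cast_zero, zero_mul, zero_add] at h1
  linarith

theorem AdmissibleDelay.sub_le_sample (hh : 0 < h) (hτ : AdmissibleDelay h τm τM τ) {ℓ : ℕ} {t : ℝ}
    (ht : t ∈ Ico (arrival h τ ℓ) (arrival h τ (ℓ + 1))) : t - (h + τM) ≤ ℓ * h := by
  have h1 := hτ.arrival_le hh (ℓ + 1)
  have h2 := ht.2
  push_cast at h1
  linarith

theorem IsSolutionInBall.isRegularAt_of_ball (hD : DissipativeBall S₁ S₂ σ (h + τM) P Q Ω ρ κ c L)
    (hσ : 0 < σ) (hh : 0 < h) (hΩ : Ω.PosDef) (hτ : AdmissibleDelay h τm τM τ)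
    (hξ : IsSolutionInBall S₁ S₂ σ h τM Ω τ w ρ ξ)
    (hball : ∀ t, arrival h τ 0 - (h + τM) ≤ t → t < T → ‖ξ t‖ < ρ) {t : ℝ}
    (ht₀ : arrival h τ 0 ≤ t) (htc : arrival h τ 0 - (h + τM) ≤ t) (htT : t < T) :
    IsRegularAt (matForm Q) (‖matForm Q‖ * L ^ 2)
      (fun s => gradient (energy S₁ S₂) (ξ s)) t := by
  obtain ⟨ℓ, hℓ⟩ := hτ.exists_mem_Ico hh ht₀
  refine hξ.isRegularAt hD hσ hΩ hℓ (hball t htc htT) (hball _ (hτ.history_le_sample hh ℓ) ?_).le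
  exact ((hτ.lt_arrival hh ℓ).trans_le hℓ.1).trans htT

/-- The Lyapunov-Krasovskii functional along the trajectory `ξ`. -/
noncomputable def functional (S₁ : PortHamiltonian n₁ m) (S₂ : PortHamiltonian n₂ m) (h τM : ℝ)
    (P Q : Matrix (Fin n₁ ⊕ Fin n₂) (Fin n₁ ⊕ Fin n₂) ℝ) (τ : ℝ → ℝ) (L : ℝ)
    (ξ : ℝ → State n₁ n₂) : ℝ → ℝ :=
  krasovskii (matForm Q) (‖matForm Q‖ * L ^ 2) (arrival h τ 0) (h + τM)
    (fun s => gradient (energy S₁ S₂) (ξ s)) (fun s => lyapunov S₁ S₂ P (ξ s))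

theorem IsSolutionInBall.functional_decay (hD : DissipativeBall S₁ S₂ σ (h + τM) P Q Ω ρ κ c L)
    (hσ : 0 < σ) (hh : 0 < h) (hτM : 0 < τM) (hP : P.PosDef) (hQ : Q.PosDef) (hΩ : Ω.PosDef)
    (hτ : AdmissibleDelay h τm τM τ) (hξ : IsSolutionInBall S₁ S₂ σ h τM Ω τ w ρ ξ)
    (hball : ∀ t, arrival h τ 0 - (h + τM) ≤ t → t < T → ‖ξ t‖ < ρ) {t : ℝ}
    (ht : arrival h τ ⌈arrival h τ 0 / h⌉₊ ≤ t) (htT : t < T) :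
    ∃ V', HasDerivWithinAt (functional S₁ S₂ h τM P Q τ L ξ) V' (Ici t) t ∧
      V' ≤ -(κ * ‖gradient (energy S₁ S₂) (ξ t)‖ ^ 2) := by
  set t₀ := arrival h τ 0 with ht₀
  have hC : 0 ≤ ‖matForm Q‖ * L ^ 2 := by positivity
  have hpos := matForm_nonneg hQ
  have ht₀t : t₀ ≤ t := (hτ.2.2 (Nat.zero_le _)).trans ht
  obtain ⟨ℓ, hℓ⟩ := hτ.exists_mem_Ico hh ht₀t
  -- From this arrival on, the sample in force was taken at `t₀` or later, so `g` is regular on all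
  -- of `[ℓh, t]` and the Wirtinger inequality applies there.
  have hs₀ : t₀ ≤ ℓ * h := by
    have : ⌈t₀ / h⌉₊ ≤ ℓ := by
      by_contra hcon
      exact ((hτ.2.2 (not_le.1 hcon)).trans ht).not_gt hℓ.2
    have h2 := Nat.ceil_le.1 this
    rwa [div_le_iff₀ hh] at h2
  have hst : ℓ * h < t := (hτ.lt_arrival hh ℓ).trans_le hℓ.1
  have hreg : ∀ s ∈ Icc (ℓ * h) t, IsRegularAt (matForm Q) (‖matForm Q‖ * L ^ 2)
      (fun s => gradient (energy S₁ S₂) (ξ s)) s := fun s hs =>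
    hξ.isRegularAt_of_ball hD hσ hh hΩ hτ hball (hs₀.trans hs.1)
      (by linarith [hs.1]) (hs.2.trans_lt htT)
  have hξt := hball t (by linarith) htT
  have hξs := hball (ℓ * h) (by linarith) (hst.trans htT)
  have hgc : ContinuousOn (fun s => gradient (energy S₁ S₂) (ξ s)) (Icc (ℓ * h) t) :=
    (continuous_gradient_energy S₁ S₂).comp_continuousOn
      (hξ.1.mono fun s hs => by simp only [mem_Ici]; linarith [hs.1])
  have hw := wirtinger_integral_inequality (matForm Q) (matForm_comm hQ) hpos hst hgc
    (dissipation_continuous (t₀ := t₀) hpos hC).continuousOn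
    (fun s hs => (hreg s ⟨hs.1, hs.2.le⟩).diff.hasDerivWithinAt)
    (fun s hs => (hreg s ⟨hs.1, hs.2.le⟩).hasDerivWithinAt_dissipation hpos hC
      (hs₀.trans hs.1))
    (ν := (t - ℓ * h)⁻¹ • ∫ s in (ℓ * h)..t, gradient (energy S₁ S₂) (ξ s))
    (by rw [smul_smul, mul_inv_cancel₀ (sub_pos.2 hst).ne', one_smul])
  have hV := (hreg t ⟨hst.le, le_rfl⟩).hasDerivWithinAt_krasovskii (δ := h + τM) hpos hC ht₀t
    (hξ.hasDerivWithinAt_lyapunov hP hℓ hξt)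
  refine ⟨_, hV, ?_⟩
  rw [derivWithin_Ici_eq (hξ.hasDerivWithinAt_gradient hℓ hξt)]
  have hdis := hD.dissipation_inequality hP hQ hξt.le hξs.le
    (sampleError_dotProduct_le S₁ hσ h hΩ w ξ ℓ)
    ((t - ℓ * h)⁻¹ • ∫ s in (ℓ * h)..t, gradient (energy S₁ S₂) (ξ s))
  have hmono := dissipation_monotone (g := fun s => gradient (energy S₁ S₂) (ξ s)) (t₀ := t₀) hpos hC
  have hle := hτ.sub_le_sample hh hℓ
  have h1 := hmono hle
  have h2 := hmono hst.le
  -- The current delay is at most `h + τM`, and `Φ` is monotone: this passes from the actual window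
  -- to the maximal one.
  have h3 : (t - ℓ * h) * (dissipation (matForm Q) (‖matForm Q‖ * L ^ 2) t₀
        (fun s => gradient (energy S₁ S₂) (ξ s)) t
      - dissipation (matForm Q) (‖matForm Q‖ * L ^ 2) t₀
        (fun s => gradient (energy S₁ S₂) (ξ s)) (ℓ * h))
      ≤ (h + τM) * (dissipation (matForm Q) (‖matForm Q‖ * L ^ 2) t₀
        (fun s => gradient (energy S₁ S₂) (ξ s)) t
      - dissipation (matForm Q) (‖matForm Q‖ * L ^ 2) t₀
        (fun s => gradient (energy S₁ S₂) (ξ s)) (t - (h + τM))) :=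
    mul_le_mul (by linarith) (by linarith) (by linarith) (by linarith)
  linarith

theorem IsSolutionInBall.lyapunov_continuousOn (hξ : IsSolutionInBall S₁ S₂ σ h τM Ω τ w ρ ξ)
    (P : Matrix (Fin n₁ ⊕ Fin n₂) (Fin n₁ ⊕ Fin n₂) ℝ) :
    ContinuousOn (fun s => lyapunov S₁ S₂ P (ξ s)) (Ici (arrival h τ 0 - (h + τM))) :=
  (continuous_lyapunov S₁ S₂ P).comp_continuousOn hξ.1

theorem IsSolutionInBall.functional_continuousOn (hξ : IsSolutionInBall S₁ S₂ σ h τM Ω τ w ρ ξ)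
    (P : Matrix (Fin n₁ ⊕ Fin n₂) (Fin n₁ ⊕ Fin n₂) ℝ) (hQ : Q.PosDef) :
    ContinuousOn (functional S₁ S₂ h τM P Q τ L ξ) (Ici (arrival h τ 0 - (h + τM))) :=
  krasovskii_continuousOn (matForm_nonneg hQ) (by positivity) (hξ.lyapunov_continuousOn P)

/-- Exponential growth bound on the time interval on which delayed samples come from the history. -/
theorem IsSolutionInBall.growth_bound (hD : DissipativeBall S₁ S₂ σ (h + τM) P Q Ω ρ κ c L)
    (hσ : 0 < σ) (hh : 0 < h) (hτM : 0 < τM) (hP : P.PosDef) (hQ : Q.PosDef) (hΩ : Ω.PosDef)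
    (hτ : AdmissibleDelay h τm τM τ) (hξ : IsSolutionInBall S₁ S₂ σ h τM Ω τ w ρ ξ)
    (hball : ∀ t, arrival h τ 0 - (h + τM) ≤ t → t < T → ‖ξ t‖ < ρ) {M₀ : ℝ}
    (hM₀ : ∀ t ∈ historyInterval h τM τ, lyapunov S₁ S₂ P (ξ t) ≤ M₀) (hM₀' : 0 ≤ M₀) {t : ℝ}
    (ht₀ : arrival h τ 0 ≤ t) (ht : t ≤ arrival h τ ⌈arrival h τ 0 / h⌉₊) (htT : t ≤ T) :
    lyapunov S₁ S₂ P (ξ t) + (h + τM) ^ 2 * dissipation (matForm Q) (‖matForm Q‖ * L ^ 2)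
        (arrival h τ 0) (fun s => gradient (energy S₁ S₂) (ξ s)) t
      ≤ Real.exp (c * (h + τM)) * (2 * M₀) := by
  set t₀ := arrival h τ 0 with ht₀_def
  have hC : 0 ≤ ‖matForm Q‖ * L ^ 2 := by positivity
  have hpos := matForm_nonneg hQ
  have hc := hD.c_nonneg
  set Φ := dissipation (matForm Q) (‖matForm Q‖ * L ^ 2) t₀
    (fun s => gradient (energy S₁ S₂) (ξ s)) with hΦ
  have hΦ₀ : ∀ s, 0 ≤ Φ s := dissipation_nonneg hpos hC
  -- The summand `M₀` absorbs the contribution of the delayed gradient, whose `P`-form is at most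
  -- `M₀`, and makes the differential inequality homogeneous.
  have hgr := le_exp_mul_of_right_deriv_le (c := c) ht₀
    (f := fun s => lyapunov S₁ S₂ P (ξ s) + (h + τM) ^ 2 * Φ s + M₀) (by
      refine ContinuousOn.add (ContinuousOn.add ?_ ?_) continuousOn_const
      · exact (hξ.lyapunov_continuousOn P).mono fun s hs => by
          simp only [mem_Ici]; linarith [hs.1]
      · exact ((dissipation_continuous hpos hC).continuousOn).const_smul ((h + τM) ^ 2))
    (fun s hs => by
      have hsT := hs.2.trans_le htT
      have hsc : t₀ - (h + τM) ≤ s := by linarith [hs.1]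
      obtain ⟨ℓ, hℓ⟩ := hτ.exists_mem_Ico hh hs.1
      have hξs := hball s hsc hsT
      have hsam : ℓ * h ∈ historyInterval h τM τ := by
        refine ⟨hτ.history_le_sample hh ℓ, ?_⟩
        have h1 : ℓ < ⌈t₀ / h⌉₊ := by
          by_contra hcon
          exact ((hs.2.trans_le ht).trans_le (hτ.2.2 (not_lt.1 hcon))).not_ge hℓ.1
        have h2 := Nat.lt_ceil.1 h1
        rw [lt_div_iff₀ hh] at h2
        exact h2.le
      have hξℓ : ‖ξ (ℓ * h)‖ < ρ := hball _ hsam.1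
        (((hτ.lt_arrival hh ℓ).trans_le hℓ.1).trans hsT)
      have hreg := hξ.isRegularAt_of_ball hD hσ hh hΩ hτ hball hs.1 hsc hsT
      refine ⟨_, ((hξ.hasDerivWithinAt_lyapunov hP hℓ hξs).add
        ((hreg.hasDerivWithinAt_dissipation hpos hC hs.1).const_mul _)).add_const _, ?_⟩
      rw [derivWithin_Ici_eq (hξ.hasDerivWithinAt_gradient hℓ hξs)]
      set x := gradient (energy S₁ S₂) (ξ s) with hx
      set d := gradient (energy S₁ S₂) (ξ (ℓ * h)) with hd
      -- No Wirtinger inequality is available across `t₀`. The free vector `ν` is taken to be the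
      -- midpoint, which kills the second square; the first is controlled by `P`.
      have hdis := hD.dissipation_inequality hP hQ hξs.le hξℓ.le
        (sampleError_dotProduct_le S₁ hσ h hΩ w ξ ℓ) ((1 / 2 : ℝ) • (x + d))
      rw [← hx, ← hd] at hdis
      have hz : x + d - (2 : ℝ) • (1 / 2 : ℝ) • (x + d) = 0 := by module
      rw [hz] at hdis
      have h0 : matForm Q 0 0 = 0 := by simp
      rw [h0] at hdis
      have h1 := matForm_sub_le hQ x d
      have h2 := hD.matForm_le x
      have h3 := hD.matForm_le d
      have h4 : matForm P x x ≤ lyapunov S₁ S₂ P (ξ s) := by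
        have := hD.energy_nonneg _ hξs.le
        unfold lyapunov; linarith
      have h5 : matForm P d d ≤ M₀ := by
        have := hD.energy_nonneg _ hξℓ.le
        have h6 := hM₀ _ hsam
        unfold lyapunov at h6; linarith
      have h6 : 0 ≤ κ * ‖x‖ ^ 2 := by have := hD.κ_pos; positivity
      have h7 : 0 ≤ (h + τM) ^ 2 * Φ s := mul_nonneg (sq_nonneg _) (hΦ₀ s)
      have h8 := mul_le_mul_of_nonneg_left h4 hc
      have h9 := mul_le_mul_of_nonneg_left h5 hc
      have h10 := mul_nonneg hc h7
      linarith)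
  -- The first sample at or after `t₀` is taken before `t₀ + h` and delayed by at most `τM`.
  have hbt : t - t₀ ≤ h + τM := by
    have h1 := hτ.arrival_le hh ⌈t₀ / h⌉₊
    have h2 := Nat.ceil_lt_add_one (show 0 ≤ t₀ / h from div_nonneg
      (by have := hτ.lt_arrival hh 0; simp at this; exact this.le) hh.le)
    have h3 := mul_lt_mul_of_pos_right h2 hh
    rw [add_mul, div_mul_cancel₀ _ hh.ne'] at h3
    linarith
  have hW₀ := hM₀ t₀ ⟨by linarith, le_rfl⟩
  have hexp : Real.exp (c * (t - t₀)) ≤ Real.exp (c * (h + τM)) :=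
    Real.exp_le_exp.2 (mul_le_mul_of_nonneg_left hbt hc)
  have hΦt₀ : Φ t₀ = 0 := dissipation_self
  simp only [hΦt₀, mul_zero, add_zero] at hgr
  calc lyapunov S₁ S₂ P (ξ t) + (h + τM) ^ 2 * Φ t
      ≤ Real.exp (c * (t - t₀)) * (lyapunov S₁ S₂ P (ξ t₀) + M₀) := by linarith
    _ ≤ Real.exp (c * (t - t₀)) * (2 * M₀) := by
        refine mul_le_mul_of_nonneg_left (by linarith) (Real.exp_pos _).le
    _ ≤ _ := mul_le_mul_of_nonneg_right hexp (by linarith)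

/-- At the arrival `t₁` the functional is at most `W + δ_M² Φ`, the quantity bounded by
`growth_bound`; afterwards it decreases and dominates `W`. Membership in the ball is required
strictly before `T` only, so `T` may be an exit time. -/
theorem IsSolutionInBall.lyapunov_le (hD : DissipativeBall S₁ S₂ σ (h + τM) P Q Ω ρ κ c L)
    (hσ : 0 < σ) (hh : 0 < h) (hτM : 0 < τM) (hP : P.PosDef) (hQ : Q.PosDef) (hΩ : Ω.PosDef)
    (hτ : AdmissibleDelay h τm τM τ) (hξ : IsSolutionInBall S₁ S₂ σ h τM Ω τ w ρ ξ)
    (hball : ∀ t, arrival h τ 0 - (h + τM) ≤ t → t < T → ‖ξ t‖ < ρ) {M₀ : ℝ}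
    (hM₀ : ∀ t ∈ historyInterval h τM τ, lyapunov S₁ S₂ P (ξ t) ≤ M₀) (hM₀' : 0 ≤ M₀)
    (hT : arrival h τ 0 ≤ T) :
    lyapunov S₁ S₂ P (ξ T) ≤ Real.exp (c * (h + τM)) * (2 * M₀) := by
  have hC : 0 ≤ ‖matForm Q‖ * L ^ 2 := by positivity
  have hpos := matForm_nonneg hQ
  rcases le_total T (arrival h τ ⌈arrival h τ 0 / h⌉₊) with hT1 | hT1
  · refine le_trans ?_ (hξ.growth_bound hD hσ hh hτM hP hQ hΩ hτ hball hM₀ hM₀' hT hT1 le_rfl)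
    exact le_add_of_nonneg_right (mul_nonneg (sq_nonneg _) (dissipation_nonneg hpos hC _))
  · set t₁ := arrival h τ ⌈arrival h τ 0 / h⌉₊ with ht₁
    have h01 : arrival h τ 0 ≤ t₁ := hτ.2.2 (Nat.zero_le _)
    have h1 := hξ.growth_bound hD hσ hh hτM hP hQ hΩ hτ hball hM₀ hM₀' h01 le_rfl hT1
    have h2 := le_of_right_deriv_nonpos (f := functional S₁ S₂ h τM P Q τ L ξ) hT1
      ((hξ.functional_continuousOn P hQ).mono fun s hs => by
        simp only [mem_Ici]; linarith [hs.1])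
      (fun s hs => by
        obtain ⟨V', hV, hle⟩ := hξ.functional_decay hD hσ hh hτM hP hQ hΩ hτ hball hs.1 hs.2
        refine ⟨V', hV, hle.trans ?_⟩
        have := hD.κ_pos
        rw [neg_nonpos]; positivity)
    have h3 : lyapunov S₁ S₂ P (ξ T) ≤ functional S₁ S₂ h τM P Q τ L ξ T :=
      le_krasovskii (W := fun s => lyapunov S₁ S₂ P (ξ s)) hpos hC (by linarith) T
    have h4 : functional S₁ S₂ h τM P Q τ L ξ t₁ ≤ _ :=
      krasovskii_le (W := fun s => lyapunov S₁ S₂ P (ξ s)) hpos hC (by linarith) t₁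
    linarith

/-- Solutions whose history lies strictly below the level of `lyapunov` on the sphere of
radius `ρ`, up to the growth factor, never leave the ball. -/
theorem IsSolutionInBall.norm_lt (hD : DissipativeBall S₁ S₂ σ (h + τM) P Q Ω ρ κ c L)
    (hσ : 0 < σ) (hh : 0 < h) (hτM : 0 < τM) (hP : P.PosDef) (hQ : Q.PosDef) (hΩ : Ω.PosDef)
    (hτ : AdmissibleDelay h τm τM τ) (hξ : IsSolutionInBall S₁ S₂ σ h τM Ω τ w ρ ξ)
    (hhist : ∀ t ∈ historyInterval h τM τ, ‖ξ t‖ < ρ) {M₀ : ℝ}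
    (hM₀ : ∀ t ∈ historyInterval h τM τ, lyapunov S₁ S₂ P (ξ t) ≤ M₀)
    (hsphere : ∀ ζ : State n₁ n₂, ‖ζ‖ = ρ →
      Real.exp (c * (h + τM)) * (2 * M₀) < lyapunov S₁ S₂ P ζ) {t : ℝ}
    (ht : arrival h τ 0 - (h + τM) ≤ t) : ‖ξ t‖ < ρ := by
  have hmem : arrival h τ 0 ∈ historyInterval h τM τ := ⟨by linarith, le_rfl⟩
  rcases le_total t (arrival h τ 0) with ht0 | ht0
  · exact hhist t ⟨ht, ht0⟩
  by_contra hcon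
  obtain ⟨T, hT, hTρ, hlt⟩ := exists_first_exit (f := fun s => ‖ξ s‖) ht0
    ((hξ.1.mono fun s hs => by simp only [mem_Ici]; linarith [hs.1]).norm) (hhist _ hmem)
    (not_lt.1 hcon)
  have hM₀' : 0 ≤ M₀ := (hD.lyapunov_nonneg hP (hhist _ hmem).le).trans (hM₀ _ hmem)
  have := hξ.lyapunov_le hD hσ hh hτM hP hQ hΩ hτ (T := T) (fun s hs hsT => by
    rcases le_total s (arrival h τ 0) with h0 | h0
    · exact hhist s ⟨hs, h0⟩
    · exact hlt s ⟨h0, hsT⟩) hM₀ hM₀' hT.1.le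
  exact (hsphere _ hTρ).not_ge this

end PortHamiltonian

/-! ### Convergence to zero. -/

theorem Matrix.PosDef.dotProduct_mulVec_pos_real {ι : Type*} [Fintype ι] {M : Matrix ι ι ℝ}
    (hM : M.PosDef) (v : ι → ℝ) (hv : v ≠ 0) : 0 < v ⬝ᵥ (M *ᵥ v) := by
  simpa using hM.dotProduct_mulVec_pos hv

/-- A Barbalat-type lemma: a nonnegative function that is dissipated by a functional bounded from
below and that decreases at a bounded rate tends to zero. -/
theorem tendsto_zero_of_dissipated {V f : ℝ → ℝ} {a κ K : ℝ} (hκ : 0 < κ) (hK : 0 ≤ K)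
    (hV : ContinuousOn V (Ici a)) (hV₀ : ∀ t ≥ a, 0 ≤ V t)
    (hV' : ∀ t ≥ a, ∃ V', HasDerivWithinAt V V' (Ici t) t ∧ V' ≤ -(κ * f t))
    (hf₀ : ∀ t, 0 ≤ f t) (hf : ∀ t ≥ a, ∀ s ≥ t, f t - K * (s - t) ≤ f s) :
    Tendsto f atTop (𝓝 0) := by
  have hanti : ∀ t ≥ a, ∀ s ≥ t, V s ≤ V t := fun t ht s hs =>
    le_of_right_deriv_nonpos hs (hV.mono fun x hx => ht.trans hx.1) fun x hx => by
      obtain ⟨V', h1, h2⟩ := hV' x (ht.trans hx.1)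
      exact ⟨V', h1, h2.trans (neg_nonpos.2 (mul_nonneg hκ.le (hf₀ x)))⟩
  have hlim : Tendsto V atTop (𝓝 (⨅ t, V (max t a))) := by
    have h1 : Tendsto (fun t => V (max t a)) atTop (𝓝 (⨅ t, V (max t a))) :=
      tendsto_atTop_ciInf (fun x y hxy => hanti _ (le_max_right _ _) _ (max_le_max_right a hxy))
        ⟨0, by rintro _ ⟨t, rfl⟩; exact hV₀ _ (le_max_right _ _)⟩
    refine h1.congr' ?_
    filter_upwards [eventually_ge_atTop a] with t ht
    rw [max_eq_left ht]
  -- On `[t, t + η]` the function `f` stays above `f t - K η`, so `V` falls by at least this much;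
  -- the drop tends to `0` since `V` converges.
  have hdrop : ∀ η ≥ 0, ∀ t ≥ a, κ * (f t - K * η) * η ≤ V t - V (t + η) := by
    intro η hη t ht
    have h := le_of_right_deriv_nonpos (a := t) (b := t + η)
      (f := fun s => V s + κ * (f t - K * η) * s) (by linarith)
      ((hV.mono fun x (hx : x ∈ Icc t (t + η)) => ht.trans hx.1).add
        (continuous_const_mul _).continuousOn) fun x hx => by
      obtain ⟨V', h1, h2⟩ := hV' x (ht.trans hx.1)
      refine ⟨_, h1.add ((hasDerivWithinAt_id x _).const_mul _), ?_⟩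
      have h3 := hf t ht x hx.1
      have h4 : K * (x - t) ≤ K * η := mul_le_mul_of_nonneg_left (by linarith [hx.2]) hK
      have h5 := mul_le_mul_of_nonneg_left (show f t - K * η ≤ f x by linarith) hκ.le
      linarith
    linarith
  rw [Metric.tendsto_nhds]
  intro ε hε
  -- Makes `K η ≤ ε / 2`; the `+ 1` covers `K = 0`.
  set η := ε / (2 * (K + 1)) with hη
  have hη0 : 0 < η := by positivity
  have hKη : K * η ≤ ε / 2 := by
    rw [hη, mul_div_assoc', div_le_div_iff₀ (by positivity) (by positivity)]
    nlinarith
  have hdiff : Tendsto (fun t => V t - V (t + η)) atTop (𝓝 0) := by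
    simpa using hlim.sub (hlim.comp (tendsto_atTop_add_const_right atTop η tendsto_id))
  filter_upwards [hdiff.eventually (gt_mem_nhds (show 0 < κ * (ε / 2) * η by positivity)),
    eventually_ge_atTop a] with t ht hta
  have h1 := (hdrop η hη0.le t hta).trans_lt ht
  have h2 := lt_of_mul_lt_mul_left (lt_of_mul_lt_mul_right h1 hη0.le) hκ.le
  rw [Real.dist_eq, sub_zero, abs_of_nonneg (hf₀ t)]
  linarith

namespace PortHamiltonian

variable {n₁ n₂ m : ℕ} {S₁ : PortHamiltonian n₁ m} {S₂ : PortHamiltonian n₂ m}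
  {σ h τm τM : ℝ} {P Q : Matrix (Fin n₁ ⊕ Fin n₂) (Fin n₁ ⊕ Fin n₂) ℝ}
  {Ω : Matrix (Fin m) (Fin m) ℝ} {τ : ℝ → ℝ} {w : Fin m → ℝ} {ρ κ c L r : ℝ}
  {ξ : ℝ → State n₁ n₂}

theorem IsSolutionInBall.tendsto_zero (hD : DissipativeBall S₁ S₂ σ (h + τM) P Q Ω ρ κ c L)
    (hσ : 0 < σ) (hh : 0 < h) (hτM : 0 < τM) (hP : P.PosDef) (hQ : Q.PosDef) (hΩ : Ω.PosDef)
    (hτ : AdmissibleDelay h τm τM τ) (hξ : IsSolutionInBall S₁ S₂ σ h τM Ω τ w ρ ξ)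
    (hball : ∀ t, arrival h τ 0 - (h + τM) ≤ t → ‖ξ t‖ < ρ)
    (hreg : ∀ ζ : State n₁ n₂, ‖ζ‖ ≤ ρ → ζ ≠ 0 → gradient (energy S₁ S₂) ζ ≠ 0) :
    Tendsto ξ atTop (𝓝 0) := by
  set g := gradient (energy S₁ S₂) with hg
  have hgc : Continuous g := continuous_gradient_energy S₁ S₂
  obtain ⟨G, hG⟩ := (isCompact_closedBall (0 : State n₁ n₂) ρ).exists_bound_of_continuousOn
    hgc.continuousOn
  set t₁ := arrival h τ ⌈arrival h τ 0 / h⌉₊ with ht₁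
  have h01 : arrival h τ 0 ≤ t₁ := hτ.2.2 (Nat.zero_le _)
  have hconv : Tendsto (fun t => ‖g (ξ t)‖ ^ 2) atTop (𝓝 0) := by
    refine tendsto_zero_of_dissipated (V := functional S₁ S₂ h τM P Q τ L ξ) (a := t₁)
      (K := 2 * (|G| * |L|)) hD.κ_pos (by positivity)
      ((hξ.functional_continuousOn P hQ).mono fun s (hs : t₁ ≤ s) => by
        simp only [mem_Ici]; linarith) (fun t ht => ?_)
      (fun t ht => hξ.functional_decay hD hσ hh hτM hP hQ hΩ hτ (T := t + 1)
        (fun s hs _ => hball s hs) ht (by linarith)) (fun t => sq_nonneg _) (fun t ht s hs => ?_)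
    · exact (hD.lyapunov_nonneg hP (hball t (by linarith)).le).trans
        (le_krasovskii (W := fun s => lyapunov S₁ S₂ P (ξ s)) (matForm_nonneg hQ) (by positivity)
          (by linarith) t)
    · have hmono := le_of_right_deriv_nonneg (a := t) (b := s)
        (f := fun u => ‖g (ξ u)‖ ^ 2 + 2 * (|G| * |L|) * u) hs
        (((hgc.comp_continuousOn (hξ.1.mono fun u hu => by
          simp only [mem_Ici]; linarith [hu.1])).norm.pow 2).add
          (continuous_const_mul _).continuousOn) fun u hu => by
        obtain ⟨ℓ, hℓ⟩ := hτ.exists_mem_Ico (t := u) hh (by linarith [hu.1])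
        have hξu := hball u (by linarith [hu.1])
        have hd := hξ.hasDerivWithinAt_gradient hℓ hξu
        refine ⟨_, hd.norm_sq.add ((hasDerivWithinAt_id u _).const_mul _), ?_⟩
        have h1 := hG (ξ u) (by simpa using hξu.le)
        have h2 := hD.norm_gradientRate_le _ _ hξu.le
          (hball _ (hτ.history_le_sample hh ℓ)).le _ (sampleError_dotProduct_le S₁ hσ h hΩ w ξ ℓ)
        have h3 := abs_real_inner_le_norm (g (ξ u))
          (gradientRate S₁ S₂ (ξ u) (ξ (ℓ * h)) (sampleError S₁ σ h Ω w ξ ℓ))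
        have h4 := mul_le_mul (h1.trans (le_abs_self G)) (h2.trans (le_abs_self L))
          (norm_nonneg _) (abs_nonneg G)
        have h5 := (abs_le.1 (h3.trans h4)).1
        linarith
      linarith
  rw [tendsto_zero_iff_norm_tendsto_zero, Metric.tendsto_nhds]
  intro ε hε
  -- On this compact shell `‖∇𝓗‖²` has a positive lower bound, which the trajectory eventually
  -- undercuts.
  have hK : IsCompact (Metric.closedBall (0 : State n₁ n₂) ρ ∩ {ζ | ε ≤ ‖ζ‖}) :=
    (isCompact_closedBall _ _).inter_right (isClosed_le continuous_const continuous_norm)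
  obtain ⟨a, ha, hle⟩ := hK.exists_forall_le' (f := fun ζ => ‖g ζ‖ ^ 2) (a := 0)
    (hgc.norm.pow 2).continuousOn fun ζ hζ => by
      have h1 : ζ ≠ 0 := by
        rintro rfl
        have : ε ≤ ‖(0 : State n₁ n₂)‖ := hζ.2
        rw [norm_zero] at this
        linarith
      have h2 := norm_pos_iff.2 (hreg ζ (by simpa using hζ.1) h1)
      positivity
  filter_upwards [hconv.eventually (gt_mem_nhds ha), eventually_ge_atTop t₁] with t ht ht1
  rw [dist_zero_right, norm_norm]
  by_contra hcon
  exact (hle (ξ t) ⟨by simpa using (hball t (by linarith)).le, not_lt.1 hcon⟩).not_gt ht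

/-! ### Choice of radii and the theorem. -/

/-- Initial functions of norm less than `r` have `lyapunov` so small that solutions are trapped
in the ball of radius `ρ`. -/
def IsTrapped (S₁ : PortHamiltonian n₁ m) (S₂ : PortHamiltonian n₂ m)
    (P : Matrix (Fin n₁ ⊕ Fin n₂) (Fin n₁ ⊕ Fin n₂) ℝ) (E r ρ : ℝ) : Prop :=
  r ≤ ρ ∧ ∃ M₀, (∀ ζ : State n₁ n₂, ‖ζ‖ < r → lyapunov S₁ S₂ P ζ ≤ M₀) ∧
    ∀ ζ : State n₁ n₂, ‖ζ‖ = ρ → E * (2 * M₀) < lyapunov S₁ S₂ P ζ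

theorem IsTrapped.norm_lt (htrap : IsTrapped S₁ S₂ P (Real.exp (c * (h + τM))) r ρ)
    (hD : DissipativeBall S₁ S₂ σ (h + τM) P Q Ω ρ κ c L)
    (hσ : 0 < σ) (hh : 0 < h) (hτM : 0 < τM) (hP : P.PosDef) (hQ : Q.PosDef) (hΩ : Ω.PosDef)
    (hτ : AdmissibleDelay h τm τM τ) (hξ : IsSolutionInBall S₁ S₂ σ h τM Ω τ w ρ ξ)
    (hhist : ∀ t ∈ historyInterval h τM τ, ‖ξ t‖ < r) {t : ℝ}
    (ht : arrival h τ 0 - (h + τM) ≤ t) : ‖ξ t‖ < ρ := by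
  obtain ⟨hr, M₀, hM₀, hsphere⟩ := htrap
  exact hξ.norm_lt hD hσ hh hτM hP hQ hΩ hτ (fun t ht => (hhist t ht).trans_le hr)
    (fun t ht => hM₀ _ (hhist t ht)) hsphere ht

theorem IsTrapped.forwardComplete (htrap : IsTrapped S₁ S₂ P (Real.exp (c * (h + τM))) r ρ)
    (hD : DissipativeBall S₁ S₂ σ (h + τM) P Q Ω ρ κ c L)
    (hσ : 0 < σ) (hh : 0 < h) (hτM : 0 < τM) (hP : P.PosDef) (hQ : Q.PosDef) (hΩ : Ω.PosDef)
    (hτ : AdmissibleDelay h τm τM τ) : ForwardComplete S₁ S₂ σ h τM Ω τ r := by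
  intro φ w hφ hr
  obtain ⟨ξ, heq, hξ⟩ := exists_isSolutionInBall (σ := σ) (Ω := Ω) S₁ S₂ hh hτM hτ w ρ hφ
  refine ⟨ξ, heq, hξ.isSolution hτ fun t ht => ?_⟩
  exact htrap.norm_lt hD hσ hh hτM hP hQ hΩ hτ hξ (fun t ht => by rw [heq ht]; exact hr t ht)
    (by linarith)

theorem lyapunov_zero (hH : RegularPosDef S₁ S₂) : lyapunov S₁ S₂ P 0 = 0 := by
  simp [lyapunov, hH.1, hH.2.1]

/-- `Ξ` is jointly continuous, so definiteness at `(0, 0)` already gives it for independent current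
and delayed states near `0`. This is why the diagonal hypothesis suffices locally. -/
theorem exists_radius (hH : RegularPosDef S₁ S₂) {δM : ℝ}
    (hXi : ∀ v, v ≠ 0 → 0 < v ⬝ᵥ (-Xi S₁ S₂ σ δM P Q Ω 0 0 *ᵥ v)) :
    ∃ ρ₀ > 0, (∀ ξ : State n₁ n₂, ‖ξ‖ ≤ ρ₀ → ξ ≠ 0 →
        0 < energy S₁ S₂ ξ ∧ gradient (energy S₁ S₂) ξ ≠ 0) ∧
      ∀ ξ ζ : State n₁ n₂, ‖ξ‖ ≤ ρ₀ → ‖ζ‖ ≤ ρ₀ → ∀ v, v ≠ 0 →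
        0 < v ⬝ᵥ (-Xi S₁ S₂ σ δM P Q Ω ξ ζ *ᵥ v) := by
  have h1 := eventually_dotProduct_mulVec_pos (p := ((0 : State n₁ n₂), (0 : State n₁ n₂)))
    (continuous_Xi S₁ S₂ σ δM P Q Ω).neg hXi
  obtain ⟨ε₁, hε₁, h1⟩ := Metric.eventually_nhds_iff.1 h1
  obtain ⟨ε₂, hε₂, h2⟩ := Metric.eventually_nhds_iff.1 (eventually_nhdsWithin_iff.1 hH.2.2)
  refine ⟨min ε₁ ε₂ / 2, by positivity, fun ξ hξ hne => h2 ?_ hne, fun ξ ζ hξ hζ =>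
    h1 (y := (ξ, ζ)) ?_⟩
  · rw [dist_zero_right]
    have := min_le_right ε₁ ε₂
    linarith
  · rw [Prod.dist_eq, dist_zero_right, dist_zero_right]
    have := min_le_left ε₁ ε₂
    exact max_lt (by linarith) (by linarith)

theorem exists_isTrapped_of_pos (hP : P.PosDef) (hH : RegularPosDef S₁ S₂) {E : ℝ} (hE : 0 < E)
    (hρ : 0 < ρ) (hpos : ∀ ξ : State n₁ n₂, ‖ξ‖ ≤ ρ → ξ ≠ 0 → 0 < energy S₁ S₂ ξ) :
    ∃ r > 0, IsTrapped S₁ S₂ P E r ρ := by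
  have hc := continuous_lyapunov S₁ S₂ P
  obtain ⟨a, ha, hle⟩ := (isCompact_sphere (0 : State n₁ n₂) ρ).exists_forall_le'
    (f := lyapunov S₁ S₂ P) (a := 0) hc.continuousOn fun ζ hζ => by
      have h1 : ‖ζ‖ = ρ := by simpa using hζ
      have h2 := hpos ζ h1.le (norm_pos_iff.1 (h1 ▸ hρ))
      exact add_pos_of_pos_of_nonneg h2 (matForm_nonneg hP _)
  -- With `M₀ = a / (4E)` the trapping level `E · 2M₀` is `a / 2`, below the bound `a` on the
  -- sphere.
  have hM : 0 < a / (4 * E) := by positivity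
  obtain ⟨r, hr, h⟩ := Metric.eventually_nhds_iff.1
    ((hc.tendsto 0).eventually (gt_mem_nhds
      (show lyapunov S₁ S₂ P 0 < a / (4 * E) by rwa [lyapunov_zero hH])))
  refine ⟨min r ρ, lt_min hr hρ, min_le_right _ _, a / (4 * E), fun ζ hζ => ?_, fun ζ hζ => ?_⟩
  · exact (h (by rw [dist_zero_right]; exact hζ.trans_le (min_le_left _ _))).le
  · refine lt_of_lt_of_le ?_ (hle ζ (by simpa using hζ))
    have : E * (2 * (a / (4 * E))) = a / 2 := by field_simp; norm_num
    linarith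

theorem exists_isTrapped_of_radiallyUnbounded (hP : P.PosDef) (hH : GloballyRegularPosDef S₁ S₂)
    (E r : ℝ) : ∃ ρ, IsTrapped S₁ S₂ P E r ρ := by
  obtain ⟨M₀, hM₀⟩ := (isCompact_closedBall (0 : State n₁ n₂) r).exists_bound_of_continuousOn
    (continuous_lyapunov S₁ S₂ P).continuousOn
  obtain ⟨κ, hκ, hκP⟩ := hP.exists_mul_dotProduct_self_le
  set M := E * (2 * M₀) with hM
  -- If `lyapunov` is at most `M`, then `𝓗 ≤ |M|` and `κ‖∇𝓗‖² ≤ |M|`, so `𝓗 + ‖∇𝓗‖` cannot exceed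
  -- this threshold.
  have hev := hH.2.2.2.eventually (eventually_gt_atTop (|M| + Real.sqrt (|M| / κ)))
  rw [← Metric.cobounded_eq_cocompact, (Metric.hasBasis_cobounded_compl_closedBall
    (0 : State n₁ n₂)).eventually_iff] at hev
  obtain ⟨ρ, -, hρ⟩ := hev
  refine ⟨max r (ρ + 1), le_max_left _ _, M₀, fun ζ hζ =>
    (le_abs_self _).trans (hM₀ ζ (by simpa using hζ.le)), fun ζ hζ => ?_⟩
  have h1 := hρ (x := ζ) (by
    simp only [mem_compl_iff, mem_closedBall_zero_iff, hζ, not_le]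
    exact (lt_add_one ρ).trans_le (le_max_right _ _))
  by_contra hcon
  rw [not_lt, ← hM] at hcon
  have hE0 : 0 ≤ energy S₁ S₂ ζ := by
    rcases eq_or_ne ζ 0 with rfl | hne
    · exact hH.1.ge
    · exact (hH.2.2.1 ζ hne).1.le
  have hP0 := matForm_nonneg hP (gradient (energy S₁ S₂) ζ)
  have h2 := hκP (gradient (energy S₁ S₂) ζ).ofLp
  rw [euclidean_ofLp_dotProduct_self, ← matForm_apply] at h2
  unfold lyapunov at hcon
  have h3 := le_abs_self M
  have h4 : ‖gradient (energy S₁ S₂) ζ‖ ≤ Real.sqrt (|M| / κ) := by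
    refine Real.le_sqrt_of_sq_le ?_
    rw [le_div_iff₀ hκ]
    linarith
  linarith

theorem isAsymptoticallyStable_of_Xi_zero (hσ : 0 < σ) (hh : 0 < h) (hτM : 0 < τM)
    (hH : RegularPosDef S₁ S₂) (hP : P.PosDef) (hQ : Q.PosDef) (hΩ : Ω.PosDef)
    (hτ : AdmissibleDelay h τm τM τ)
    (hXi : ∀ v, v ≠ 0 → 0 < v ⬝ᵥ (-Xi S₁ S₂ σ (h + τM) P Q Ω 0 0 *ᵥ v)) :
    IsAsymptoticallyStable S₁ S₂ σ h τM Ω τ := by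
  obtain ⟨c, hc, hPQ⟩ := hP.exists_matForm_le Q
  obtain ⟨ρ₀, hρ₀, hreg, hneg⟩ := exists_radius hH hXi
  have hball : ∀ ρ, ρ ≤ ρ₀ → ∃ κ L, DissipativeBall S₁ S₂ σ (h + τM) P Q Ω ρ κ c L := fun ρ hρ =>
    exists_dissipativeBall S₁ S₂ hΩ hc hPQ (fun ξ hξ => by
      rcases eq_or_ne ξ 0 with rfl | hne
      · exact hH.1.ge
      · exact (hreg ξ (hξ.trans hρ) hne).1.le)
      fun ξ ζ hξ hζ => hneg ξ ζ (hξ.trans hρ) (hζ.trans hρ)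
  refine ⟨fun ε hε => ?_, ?_⟩
  · obtain ⟨κ, L, hD⟩ := hball (min ε ρ₀) (min_le_right _ _)
    obtain ⟨r, hr, htrap⟩ := exists_isTrapped_of_pos hP hH (Real.exp_pos (c * (h + τM)))
      (lt_min hε hρ₀) fun ξ hξ hne => (hreg ξ (hξ.trans (min_le_right _ _)) hne).1
    refine ⟨r, hr, htrap.forwardComplete hD hσ hh hτM hP hQ hΩ hτ, fun w ξ hξ hhist t ht => ?_⟩
    exact (htrap.norm_lt hD hσ hh hτM hP hQ hΩ hτ (hξ.isSolutionInBall _) hhist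
      (by linarith)).trans_le (min_le_left _ _)
  · obtain ⟨κ, L, hD⟩ := hball ρ₀ le_rfl
    obtain ⟨r, hr, htrap⟩ := exists_isTrapped_of_pos hP hH (Real.exp_pos (c * (h + τM)))
      hρ₀ fun ξ hξ hne => (hreg ξ hξ hne).1
    refine ⟨r, hr, fun w ξ hξ hhist => ?_⟩
    exact (hξ.isSolutionInBall ρ₀).tendsto_zero hD hσ hh hτM hP hQ hΩ hτ
      (fun t ht => htrap.norm_lt hD hσ hh hτM hP hQ hΩ hτ (hξ.isSolutionInBall _) hhist ht)
      fun ζ hζ hne => (hreg ζ hζ hne).2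

end PortHamiltonian

/-- For constant `G₁` the matrix `Ξ(ξ, ζ)` does not depend on `ζ`, so the hypothesis of the global
part is then the diagonal one. Stability in the global part is the local result; the rest applies
trapping in arbitrarily large balls. -/
theorem theorem1 {n₁ n₂ m : ℕ} (S₁ : PortHamiltonian n₁ m) (S₂ : PortHamiltonian n₂ m)
    (σ h τM : ℝ) (hσ : 0 < σ) (hh : 0 < h) (hτM : 0 < τM)
    (hH : PortHamiltonian.RegularPosDef S₁ S₂)
    (P Q : Matrix (Fin n₁ ⊕ Fin n₂) (Fin n₁ ⊕ Fin n₂) ℝ) (Ω : Matrix (Fin m) (Fin m) ℝ)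
    (hP : P.PosDef) (hQ : Q.PosDef) (hΩ : Ω.PosDef)
    (τm : ℝ) (τ : ℝ → ℝ) (hτ : PortHamiltonian.AdmissibleDelay h τm τM τ) :
    ((∀ᶠ ξ in 𝓝 (0 : PortHamiltonian.State n₁ n₂),
        (-PortHamiltonian.Xi S₁ S₂ σ (h + τM) P Q Ω ξ ξ).PosDef) →
      PortHamiltonian.IsAsymptoticallyStable S₁ S₂ σ h τM Ω τ) ∧
    ((∀ ξ ζ : PortHamiltonian.State n₁ n₂,
        (-PortHamiltonian.Xi S₁ S₂ σ (h + τM) P Q Ω ξ ζ).PosDef) →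
      PortHamiltonian.GloballyRegularPosDef S₁ S₂ →
      PortHamiltonian.IsGloballyAsymptoticallyStable S₁ S₂ σ h τM Ω τ) := by
  refine ⟨fun hXi => PortHamiltonian.isAsymptoticallyStable_of_Xi_zero hσ hh hτM hH hP hQ hΩ hτ
    hXi.self_of_nhds.dotProduct_mulVec_pos_real, fun hXi hG => ?_⟩
  obtain ⟨c, hc, hPQ⟩ := hP.exists_matForm_le Q
  have hball : ∀ ρ, ∃ κ L, PortHamiltonian.DissipativeBall S₁ S₂ σ (h + τM) P Q Ω ρ κ c L :=
    fun ρ => PortHamiltonian.exists_dissipativeBall S₁ S₂ hΩ hc hPQ (fun ξ _ => by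
      rcases eq_or_ne ξ 0 with rfl | hne
      · exact hG.1.ge
      · exact (hG.2.2.1 ξ hne).1.le)
      fun ξ ζ _ _ => (hXi ξ ζ).dotProduct_mulVec_pos_real
  refine ⟨(PortHamiltonian.isAsymptoticallyStable_of_Xi_zero hσ hh hτM hH hP hQ hΩ hτ
    (hXi 0 0).dotProduct_mulVec_pos_real).1, fun r => ?_, fun w ξ hξ => ?_⟩
  · obtain ⟨ρ, htrap⟩ := PortHamiltonian.exists_isTrapped_of_radiallyUnbounded hP hG
      (Real.exp (c * (h + τM))) r
    obtain ⟨κ, L, hD⟩ := hball ρ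
    exact htrap.forwardComplete hD hσ hh hτM hP hQ hΩ hτ
  -- Every history is bounded by compactness; `r + 1` makes the bound strict.
  · obtain ⟨r, hr⟩ := (isCompact_Icc (a := PortHamiltonian.arrival h τ 0 - (h + τM))
      (b := PortHamiltonian.arrival h τ 0)).exists_bound_of_continuousOn
      (hξ.1.mono Icc_subset_Ici_self)
    obtain ⟨ρ, htrap⟩ := PortHamiltonian.exists_isTrapped_of_radiallyUnbounded hP hG
      (Real.exp (c * (h + τM))) (r + 1)
    obtain ⟨κ, L, hD⟩ := hball ρ
    exact (hξ.isSolutionInBall ρ).tendsto_zero hD hσ hh hτM hP hQ hΩ hτ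
      (fun t ht => htrap.norm_lt hD hσ hh hτM hP hQ hΩ hτ (hξ.isSolutionInBall _)
        (fun t ht => (hr t ht).trans_lt (lt_add_one r)) ht) fun ζ _ hne => (hG.2.2.1 ζ hne).2
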